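/- Let $m>1$ be an integer with $m\not\equiv 2\pmod 4$, let $K=\mathbb{Q}(\zeta_m)$ with ring of integers $\mathbb{Z}[\zeta_m]$ and $G_m=\mathrm{Gal}(K/\mathbb{Q})$, and for $s$ prime to $m$ let $\sigma_s\in G_m$ be the automorphism raising every $m$th root of unity to its $s$th power. For $a\in\mathbb{Z}$ put $$\theta_m(a)=\sum_{0<s\le m,\ (s,m)=1}\Bigl\langle -\frac{as}{m}\Bigr\rangle\,\sigma_s^{-1}\in\mathbb{Q}[G_m],\qquad N_m=\sum_{\tau\in G_m}\tau ,$$ where $\langle x\rangle$ is the fractional part of $x$. Let $\ell$ be a prime not dividing $m$, let $\mathfrak{L}$ be a prime ideal of $\mathbb{Z}[\zeta_m]$ above $\ell$, and let $\mathbb{F}=\mathbb{Z}[\zeta_m]/\mathfrak{L}$. Let $\chi_{\mathfrak{L}}$ be the $m$th power residue symbol: for $a\in\mathbb{F}^\times$, $\chi_{\mathfrak{L}}(a)$ is the $m$th root of unity that lies in the class $a^{(N(\mathfrak{L})-1)/m}$, and $\chi_{\mathfrak{L}}(0)=0$. For $b,c\in\mathbb{Z}$ not divisible by $m$ let $$J(b,c,\mathfrak{L})=-\sum_{a\in\mathbb{F}}\chi_{\mathfrak{L}}(a)^b\,\chi_{\mathfrak{L}}(1-a)^c\in\mathbb{Z}[\zeta_m]$$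 (each of the characters $\chi_{\mathfrak{L}}^b,\chi_{\mathfrak{L}}^c$ takes the value $0$ at $0$). For $\alpha=\sum_\sigma a_\sigma\sigma\in\mathbb{Z}[G_m]$ let $\mathfrak{L}^\alpha=\prod_\sigma\sigma(\mathfrak{L})^{a_\sigma}$, and call $\alpha$ short if all $a_\sigma\in\{0,1\}$. (i) For all $b,c\in\mathbb{Z}$ with $m\nmid b$, $m\nmid c$, $m\nmid b+c$, the element $\alpha=\theta_m(b)+\theta_m(c)-\theta_m(b+c)$ is a short element of $\mathbb{Z}[G_m]$, and $$J(b,c,\mathfrak{L})\cdot\mathbb{Z}[\zeta_m]=\mathfrak{L}^{\alpha}.$$ (ii) Write $m=q_1\cdots q_t$ with pairwise coprime prime powers $q_i$ in any fixed order, let $p_i$ be the prime dividing $q_i$, and let $\varphi$ be Euler's function. For an integer $b$ with $0<b<m$ let $J'_b=\{i: q_i\nmid b\}$ and $r_b=\prod_{i\notin J'_b}q_i$, and define $\alpha_m(b)$ as follows. - If $|J'_b|>1$: let $u=q_{\min J'_b}$, $v=m/(ur_b)$, let $x,y\in\mathbb{Z}$ satisfy $ux+vy=-1$, and put $\alpha_m(b)=\theta_m(b)+\theta_m(bux)+\theta_m(bvy)-N_m$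 (which does not depend on the choice of $x,y$). - If $J'_b=\{j\}$ and $b\ne m/q_j$: $\alpha_m(b)=\theta_m(-b)+\theta_m(b-\tfrac{m}{q_j})+\theta_m(\tfrac{m}{q_j})-N_m$. - If $J'_b=\{j\}$ and $b=m/q_j$: $\alpha_m(b)=2\theta_m\bigl(\tfrac{m\varphi(q_j)}{2q_j}\bigr)+\theta_m(\tfrac{m}{p_j})-N_m$. Then $\alpha_m(b)$ is a short element of $\mathbb{Z}[G_m]$, and the ideal $\mathfrak{L}^{\alpha_m(b)}$ is generated in these three cases respectively by $$J(bux,bvy,\mathfrak{L})\ \text{ (for every solution } x,y \text{ of } ux+vy=-1),\qquad J\bigl(b-\tfrac{m}{q_j},\tfrac{m}{q_j},\mathfrak{L}\bigr),\qquad J\bigl(\tfrac{m\varphi(q_j)}{2q_j},\tfrac{m\varphi(q_j)}{2q_j},\mathfrak{L}\bigr).$$ -/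

import Mathlib

open scoped NumberField nonZeroDivisors Pointwise

namespace ShortStickelberger

noncomputable section

/-! ### The power residue symbol and Jacobi sums -/

section Symbol

variable {K : Type*} [Field K] [NumberField K]

/-- `χ` is the `m`-th power residue symbol modulo `L`: for every invertible class `a` modulo `L`,
`χ a` is an `m`-th root of unity lying in the class `a ^ ((N(L) - 1) / m)`.
(A multiplicative character vanishes at non-invertible classes, so `χ 0 = 0`.) -/
def IsPowerResidueSymbol (m : ℕ) (L : Ideal (𝓞 K)) (χ : MulChar (𝓞 K ⧸ L) (𝓞 K)) : Prop :=
  ∀ a : (𝓞 K ⧸ L)ˣ, χ a ^ m = 1 ∧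
    Ideal.Quotient.mk L (χ a) = (a : 𝓞 K ⧸ L) ^ ((Ideal.absNorm L - 1) / m)

/-- If `K = ℚ(ζ_m)` and `L` is a maximal ideal of `𝓞 K` of norm prime to `m`, then there is
exactly one `m`-th power residue symbol modulo `L`. -/
theorem existsUnique_isPowerResidueSymbol (m : ℕ) [NeZero m] [IsCyclotomicExtension {m} ℚ K]
    (L : Ideal (𝓞 K)) [L.IsMaximal] (hL : (Ideal.absNorm L).Coprime m) :
    ∃! χ : MulChar (𝓞 K ⧸ L) (𝓞 K), IsPowerResidueSymbol m L χ := by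
  classical
  let _ : Field (𝓞 K ⧸ L) := Ideal.Quotient.field L
  let _ : Fintype (𝓞 K ⧸ L) := Fintype.ofFinite _
  have h1 : Ideal.absNorm L ≠ 1 :=
    Ideal.absNorm_eq_one_iff.not.mpr (Ideal.IsMaximal.ne_top inferInstance)
  have inj := Ideal.rootsOfUnityMapQuot_injective (I := L) m h1 hL
  have hζ := (IsCyclotomicExtension.zeta_spec m ℚ K).toInteger_isPrimitiveRoot
  have hζ' := hζ.idealQuotient_mk h1 hL
  have hcard : Fintype.card (𝓞 K ⧸ L) = Ideal.absNorm L := by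
    rw [Fintype.card_eq_nat_card]; rfl
  have hdvd : m ∣ Ideal.absNorm L - 1 := by
    rw [hζ'.eq_orderOf, ← hcard]
    exact orderOf_dvd_of_pow_eq_one
      (FiniteField.pow_card_sub_one_eq_one _ (hζ'.ne_zero (NeZero.ne m)))
  have key : ∀ a : (𝓞 K ⧸ L)ˣ, ∃ z : rootsOfUnity m (𝓞 K),
      Ideal.rootsOfUnityMapQuot L m z = a ^ ((Ideal.absNorm L - 1) / m) := by
    intro a
    have h : ((a : 𝓞 K ⧸ L) ^ ((Ideal.absNorm L - 1) / m)) ^ m = 1 := by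
      rw [← pow_mul, Nat.div_mul_cancel hdvd, ← hcard]
      exact FiniteField.pow_card_sub_one_eq_one _ a.ne_zero
    obtain ⟨i, -, hi⟩ := hζ'.eq_pow_of_pow_eq_one h
    refine ⟨hζ.toRootsOfUnity ^ i, ?_⟩
    ext
    rw [map_pow, Units.val_pow_eq_pow_val, Units.val_pow_eq_pow_val, ← hi]
    rfl
  choose f hf using key
  let F : (𝓞 K ⧸ L)ˣ →* (𝓞 K)ˣ := (rootsOfUnity m (𝓞 K)).subtype.comp
    { toFun := f
      map_one' := inj (by rw [hf, one_pow, map_one])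
      map_mul' := fun a b => inj (by rw [hf, map_mul, hf, hf, mul_pow]) }
  refine ⟨MulChar.ofUnitHom F, fun a => ?_, fun ψ hψ => ?_⟩
  · rw [MulChar.ofUnitHom_coe]
    refine ⟨?_, ?_⟩
    · have := (f a).2
      rw [mem_rootsOfUnity] at this
      have h := congrArg Units.val this
      rw [Units.val_pow_eq_pow_val, Units.val_one] at h
      exact h
    · have := congrArg Units.val (hf a)
      rw [Units.val_pow_eq_pow_val] at this
      exact this
  · ext a
    rw [MulChar.ofUnitHom_coe]
    obtain ⟨h2, h3⟩ := hψ a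
    have h4 : ψ.toUnitHom a ∈ rootsOfUnity m (𝓞 K) := by
      rw [mem_rootsOfUnity]
      ext1
      rw [Units.val_pow_eq_pow_val, MulChar.coe_toUnitHom, h2, Units.val_one]
    have h5 : (⟨ψ.toUnitHom a, h4⟩ : rootsOfUnity m (𝓞 K)) = f a := by
      apply inj
      rw [hf]
      ext1
      rw [Ideal.rootsOfUnityMapQuot_apply, MulChar.coe_toUnitHom, h3, Units.val_pow_eq_pow_val]
    have h6 : ψ.toUnitHom a = ((f a : rootsOfUnity m (𝓞 K)) : (𝓞 K)ˣ) := congrArg Subtype.val h5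
    rw [← MulChar.coe_toUnitHom, h6]
    rfl

open Classical in
/-- The `m`-th power residue symbol `χ_L` modulo `L`
(see `existsUnique_isPowerResidueSymbol`; the second branch is a junk value). -/
def powerResidueSymbol (m : ℕ) (L : Ideal (𝓞 K)) : MulChar (𝓞 K ⧸ L) (𝓞 K) :=
  if h : ∃ χ : MulChar (𝓞 K ⧸ L) (𝓞 K), IsPowerResidueSymbol m L χ then h.choose else 1

theorem powerResidueSymbol_spec (m : ℕ) [NeZero m] [IsCyclotomicExtension {m} ℚ K]
    (L : Ideal (𝓞 K)) [L.IsMaximal] (hL : (Ideal.absNorm L).Coprime m) :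
    IsPowerResidueSymbol m L (powerResidueSymbol m L) := by
  have h := (existsUnique_isPowerResidueSymbol m L hL).exists
  rw [powerResidueSymbol, dif_pos h]
  exact h.choose_spec

/-- The Jacobi sum `J(b, c, L) = - ∑_{a ∈ 𝓞 K ⧸ L} χ_L(a) ^ b * χ_L(1 - a) ^ c`. -/
def jacobi (m : ℕ) (b c : ℤ) (L : Ideal (𝓞 K)) [L.IsMaximal] : 𝓞 K :=
  letI : Fintype (𝓞 K ⧸ L) := Fintype.ofFinite _;
  -(jacobiSum (powerResidueSymbol m L ^ b) (powerResidueSymbol m L ^ c))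

end Symbol

/-! ### The group ring of the Galois group -/

section GroupRing

variable (K : Type*) [Field K] [NumberField K]

/-- The absolute norm element `N_m`, the sum of all elements of the Galois group. -/
def normElt : MonoidAlgebra ℚ Gal(K/ℚ) :=
  ∑ σ : Gal(K/ℚ), MonoidAlgebra.single σ 1

/-- `θ_m(a) = ∑_s ⟨-a s / m⟩ σ_s⁻¹`, where `s` runs over the residues prime to `m`, `σ_s` is the
automorphism of `ℚ(ζ_m)` raising every `m`-th root of unity to the power `s`, and `⟨x⟩` is the
fractional part of `x`. -/
def theta (m : ℕ) [NeZero m] [IsCyclotomicExtension {m} ℚ K] (a : ℤ) :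
    MonoidAlgebra ℚ Gal(K/ℚ) :=
  ∑ s : (ZMod m)ˣ,
    MonoidAlgebra.single ((IsCyclotomicExtension.Rat.galEquivZMod m K).symm s)⁻¹
      (Int.fract (-((a : ℚ) * ((s : ZMod m).val : ℚ)) / (m : ℚ)))

variable {K}

/-- The embedding of `ℤ[G]` into `ℚ[G]`. -/
def toRat (α : MonoidAlgebra ℤ Gal(K/ℚ)) : MonoidAlgebra ℚ Gal(K/ℚ) :=
  MonoidAlgebra.mapRingHom Gal(K/ℚ) (Int.castRingHom ℚ) α

/-- An element of `ℤ[G]` is short if all its coefficients are `0` or `1`. -/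
def IsShort (α : MonoidAlgebra ℤ Gal(K/ℚ)) : Prop :=
  ∀ σ : Gal(K/ℚ), α.coeff σ = 0 ∨ α.coeff σ = 1

/-- `L ^ α = ∏_σ σ(L) ^ {a_σ}` for `α = ∑ a_σ σ ∈ ℤ[G]`, as a fractional ideal. -/
def idealPow (L : Ideal (𝓞 K)) (α : MonoidAlgebra ℤ Gal(K/ℚ)) : FractionalIdeal (𝓞 K)⁰ K :=
  ∏ σ : Gal(K/ℚ), ((σ • L : Ideal (𝓞 K)) : FractionalIdeal (𝓞 K)⁰ K) ^ (α.coeff σ)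

/-- The principal fractional ideal `x · 𝓞 K` of an algebraic integer `x`. -/
def principal (x : 𝓞 K) : FractionalIdeal (𝓞 K)⁰ K :=
  ((Ideal.span {x} : Ideal (𝓞 K)) : FractionalIdeal (𝓞 K)⁰ K)

end GroupRing

/-! ### The elements `α_m(b)`

Here `q 0, …, q (t - 1)` are the prime powers with `m = ∏ i, q i`, in some fixed order. -/

section Alpha

variable {t : ℕ} (q : Fin t → ℕ)

/-- `J_b = {i | q_i ∣ b}`. -/
def J (b : ℤ) : Finset (Fin t) := {i | (q i : ℤ) ∣ b}

/-- `J'_b = {i | q_i ∤ b}`. -/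
def J' (b : ℤ) : Finset (Fin t) := {i | ¬ (q i : ℤ) ∣ b}

/-- `r_b = ∏_{i ∈ J_b} q_i`. -/
def r (b : ℤ) : ℕ := ∏ i ∈ J q b, q i

/-- The element `α_m(b)`, for `0 < b < m`.
* If `J'_b` has more than one element, put `u = q_{min J'_b}`, `v = m / (u r_b)` and let `x, y` be
  the solution of `u x + v y = -1` given by the extended Euclidean algorithm; then
  `α_m(b) = θ_m(b) + θ_m(b u x) + θ_m(b v y) - N_m` (any other solution gives the same element).
* If `J'_b = {j}` and `b = m / q_j`, then
  `α_m(b) = 2 θ_m(m φ(q_j) / (2 q_j)) + θ_m(m / p_j) - N_m`, `p_j` being the prime dividing `q_j`.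
* If `J'_b = {j}` and `b ≠ m / q_j`, then
  `α_m(b) = θ_m(-b) + θ_m(b - m / q_j) + θ_m(m / q_j) - N_m`. -/
def alpha (K : Type*) [Field K] [NumberField K] (m : ℕ) [NeZero m]
    [IsCyclotomicExtension {m} ℚ K] (b : ℤ) : MonoidAlgebra ℚ Gal(K/ℚ) :=
  if hb : (J' q b).Nonempty then
    let j := (J' q b).min' hb
    if 1 < (J' q b).card then
      let u : ℕ := q j
      let v : ℕ := m / (u * r q b)
      let x : ℤ := -Nat.gcdA u v
      let y : ℤ := -Nat.gcdB u v
      theta K m b + theta K m (b * u * x) + theta K m (b * v * y) - normElt K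
    else if b = ((m / q j : ℕ) : ℤ) then
      2 * theta K m ((m * Nat.totient (q j) / (2 * q j) : ℕ) : ℤ)
        + theta K m ((m / (q j).minFac : ℕ) : ℤ) - normElt K
    else
      theta K m (-b) + theta K m (b - ((m / q j : ℕ) : ℤ)) + theta K m ((m / q j : ℕ) : ℤ)
        - normElt K
  else 0

end Alpha

end

end ShortStickelberger

/-! Part (i) is Stickelberger's theorem for Jacobi sums, proved by valuations. Let `p = ℓ`, let `p ^
f = N(L)`, and let `θ` be the inverse Teichmüller character with values in an extension containing
the roots of unity of order `p (p ^ f - 1)`. The valuation of the Gauss sum `g(θ ^ n)` at a prime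
above `L` is that of `g(θ)` raised to the base-`p` digit sum of `n`, which is `(p - 1)` times
`fractSum p f n` for `0 ≤ n < p ^ f - 1`. This goes by induction on `n`. Frobenius invariance gives
`g(θ ^ (p n)) = g(θ ^ n)`. For `p ∤ n + 1` the Jacobi sum linking `g(θ ^ n) g(θ)` to `g(θ ^ (n +
1))` is congruent to `-(n + 1)`, hence a unit. The relation `g(θ) g(θ⁻¹) = ± p ^ f` then fixes the
scale: `g(θ) ^ (p - 1)` has the valuation of `p`.

Since `χ_L` is a power of `θ`, this gives the valuation of `J(b, c, L)` at `L`. At the conjugate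
`σ_s⁻¹(L)` it equals the valuation at `L` of `σ_s J(b, c, L) = J(s b, s c, L)`. The stabilizer of
`L` is generated by `σ_ℓ`, so the exponent of that conjugate in `L ^ α` is a sum over the powers of
`ℓ`, and the two agree (`principal_jacobi`). Away from `ℓ`, `J(b, c, L) J(-b, -c, L) = ℓ ^ f` makes
the Jacobi sum a unit. Shortness holds because `⟨x⟩ + ⟨y⟩ - ⟨x + y⟩` is `0` or `1`.

Part (ii) reduces to part (i) by the reflection `θ_m(a) + θ_m(-a) = N_m`: each `α_m(b)` becomes
`θ_m(b') + θ_m(c') - θ_m(b' + c')`, where `b', c'` are the arguments of the Jacobi sum. -/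

/-! ### Sums of fractional parts over the powers of a prime -/

/-- The sum of the fractional parts of `p ^ i * a / (p ^ f - 1)` for `0 ≤ i < f`. -/
def fractSum (p f : ℕ) (a : ℤ) : ℚ :=
  ∑ i ∈ Finset.range f, Int.fract ((p : ℚ) ^ i * a / ((p : ℚ) ^ f - 1))

/-- Multiplication by `p ^ i` modulo `p ^ f - 1` rotates the `f` base-`p` digits. When `p ∤ n + 1`,
passing from `n` to `n + 1` only raises the last digit, so no carry occurs after the rotation
either. -/
theorem pow_mul_succ_mod {p f i n : ℕ} (hp : 1 < p) (hi : i < f) (hn : n + 1 < p ^ f - 1)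
    (hpn : ¬ p ∣ n + 1) :
    (p ^ i * (n + 1)) % (p ^ f - 1) = (p ^ i * n) % (p ^ f - 1) + p ^ i := by
  have hpos : 0 < p ^ i := by positivity
  obtain ⟨N, hN⟩ : ∃ N, p ^ f = N + 1 := ⟨p ^ f - 1, by omega⟩
  have hf : p ^ i * p ^ (f - i) = N + 1 := by rw [← hN, ← pow_add]; congr 1; omega
  rw [hN, Nat.add_sub_cancel] at hn ⊢
  have hN0 : 0 < N := by omega
  have hdiv := Nat.div_add_mod (p ^ i * n) N
  have hlt := Nat.mod_lt (p ^ i * n) hN0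
  set r := (p ^ i * n) % N
  set c := (p ^ i * n) / N with hc
  set A := p ^ i
  suffices h : r + A < N by
    rw [mul_add, mul_one, ← hdiv, add_assoc, Nat.mul_add_mod, Nat.mod_eq_of_lt h]
  by_contra hcon
  obtain ⟨s, hs⟩ : ∃ s, r + A = N + s := ⟨r + A - N, by omega⟩
  have hsA : s < A := by omega
  have hcA : c < A := by
    rw [hc, Nat.div_lt_iff_lt_mul hN0]
    exact Nat.mul_lt_mul_of_pos_left (by omega) hpos
  -- If the sum wrapped around, then `A (n + 1) = N (c + 1) + s`. Writing `N = p ^ f - 1` and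
  -- reducing modulo `A` gives `c + 1 ≡ s`, so either `s = c + 1` and `p ∣ n + 1`, or `c + 1 = A`,
  -- `s = 0` and `n + 1 = N`.
  have key : A * (n + 1) + (c + 1) = A * (p ^ (f - i) * (c + 1)) + s := by
    rw [← mul_assoc, hf]; linarith
  have hmod : (c + 1) % A = s := by
    have := congrArg (· % A) key
    simpa [Nat.mul_add_mod, Nat.mod_eq_of_lt hsA] using this
  rcases (Nat.succ_le_of_lt hcA).lt_or_eq with h | h
  · rw [Nat.mod_eq_of_lt h] at hmod
    have h2 : A * (n + 1) = A * (p ^ (f - i) * (c + 1)) := by omega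
    have h3 := Nat.eq_of_mul_eq_mul_left hpos h2
    apply hpn
    rw [h3]
    exact (dvd_pow_self p (by omega)).mul_right _
  · have h' : c + 1 = A := h
    rw [h', Nat.mod_self] at hmod
    rw [h', ← hmod, mul_comm (p ^ (f - i)), hf] at key
    have h3 : n + 1 + 1 = N + 1 := Nat.eq_of_mul_eq_mul_left hpos (by linarith)
    omega

section FractSum

variable {p f : ℕ}

theorem cast_pow_sub_one (hp : 1 < p) : ((p ^ f - 1 : ℕ) : ℚ) = (p : ℚ) ^ f - 1 := by
  rw [Nat.cast_sub (Nat.one_le_pow _ _ (by omega))]; simp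

theorem fract_eq_mod (hp : 1 < p) (i n : ℕ) :
    Int.fract ((p : ℚ) ^ i * ((n : ℤ) : ℚ) / ((p : ℚ) ^ f - 1)) =
      ((p ^ i * n % (p ^ f - 1) : ℕ) : ℚ) / ((p : ℚ) ^ f - 1) := by
  rw [← cast_pow_sub_one hp, ← Int.fract_div_natCast_eq_div_natCast_mod]
  push_cast; rfl

theorem pow_sub_one_ne_zero (hp : 1 < p) (hf : f ≠ 0) : (p : ℚ) ^ f - 1 ≠ 0 := by
  have : (1 : ℚ) < (p : ℚ) ^ f := one_lt_pow₀ (by exact_mod_cast hp) hf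
  linarith

theorem fractSum_add_mul (hp : 1 < p) (hf : f ≠ 0) (a c : ℤ) :
    fractSum p f (a + ((p ^ f - 1 : ℕ) : ℤ) * c) = fractSum p f a := by
  refine Finset.sum_congr rfl fun i _ => ?_
  rw [Int.fract_eq_fract]
  refine ⟨p ^ i * c, ?_⟩
  have := pow_sub_one_ne_zero hp hf
  have h := cast_pow_sub_one (f := f) hp
  push_cast
  rw [h]
  field_simp
  ring

theorem fractSum_congr (hp : 1 < p) (hf : f ≠ 0) {a b : ℤ}
    (h : ((p ^ f - 1 : ℕ) : ℤ) ∣ a - b) : fractSum p f a = fractSum p f b := by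
  obtain ⟨c, hc⟩ := h
  rw [show a = b + ((p ^ f - 1 : ℕ) : ℤ) * c by linarith, fractSum_add_mul hp hf]

/-- The terms are permuted cyclically: modulo integers, `p ^ f * a / (p ^ f - 1)` is `a / (p ^ f -
1)`. -/
theorem fractSum_mul (hp : 1 < p) (hf : f ≠ 0) (a : ℤ) :
    fractSum p f (p * a) = fractSum p f a := by
  have h0 := pow_sub_one_ne_zero hp hf
  obtain ⟨g, rfl⟩ := Nat.exists_eq_add_one_of_ne_zero hf
  rw [fractSum, fractSum, Finset.sum_range_succ, Finset.sum_range_succ']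
  congr 1
  · refine Finset.sum_congr rfl fun i _ => ?_
    congr 1; push_cast; ring
  · rw [Int.fract_eq_fract]
    refine ⟨a, ?_⟩
    push_cast
    field_simp
    ring

theorem fractSum_succ (hp : 1 < p) {n : ℕ} (hn : n + 1 < p ^ f - 1) (hpn : ¬ p ∣ n + 1) :
    fractSum p f ((n : ℤ) + 1) = fractSum p f n + fractSum p f 1 := by
  rw [fractSum, fractSum, fractSum, ← Finset.sum_add_distrib]
  refine Finset.sum_congr rfl fun i hi => ?_
  rw [Finset.mem_range] at hi
  have h1 := fract_eq_mod (f := f) hp i (n + 1)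
  have h2 := fract_eq_mod (f := f) hp i n
  have h3 := fract_eq_mod (f := f) hp i 1
  have e1 := pow_mul_succ_mod hp hi hn hpn
  have e2 := pow_mul_succ_mod (n := 0) hp hi (by omega) (by simpa using hp.ne')
  simp only [mul_zero, Nat.zero_mod, zero_add] at e2
  rw [e1] at h1
  rw [e2] at h3
  push_cast at h1 h3 h2 ⊢
  rw [h1, h2, h3, add_div]

theorem fractSum_one (hp : 1 < p) (hf : 2 < p ^ f) :
    fractSum p f 1 = 1 / ((p : ℚ) - 1) := by
  have hf0 : f ≠ 0 := by rintro rfl; simp at hf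
  have h0 := pow_sub_one_ne_zero hp hf0
  have hp1 : (p : ℚ) - 1 ≠ 0 := by
    have : (1 : ℚ) < p := by exact_mod_cast hp
    linarith
  have : fractSum p f 1 = ∑ i ∈ Finset.range f, (p : ℚ) ^ i / ((p : ℚ) ^ f - 1) := by
    refine Finset.sum_congr rfl fun i hi => ?_
    rw [Finset.mem_range] at hi
    have h3 := fract_eq_mod (f := f) hp i 1
    have e2 := pow_mul_succ_mod (n := 0) hp hi (by omega) (by simpa using hp.ne')
    simp only [mul_zero, Nat.zero_mod, zero_add] at e2
    rw [e2] at h3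
    push_cast at h3 ⊢
    exact h3
  rw [this, ← Finset.sum_div, geom_sum_eq (by exact_mod_cast hp.ne')]
  field_simp

theorem fractSum_add_neg (hp : 1 < p) {a : ℤ} (ha : ¬ ((p ^ f - 1 : ℕ) : ℤ) ∣ a) :
    fractSum p f a + fractSum p f (-a) = f := by
  rw [fractSum, fractSum, ← Finset.sum_add_distrib]
  have : ∀ i ∈ Finset.range f, Int.fract ((p : ℚ) ^ i * (a : ℤ) / ((p : ℚ) ^ f - 1)) +
      Int.fract ((p : ℚ) ^ i * ((-a : ℤ) : ℚ) / ((p : ℚ) ^ f - 1)) = 1 := by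
    intro i hi
    rw [Finset.mem_range] at hi
    have h0 := pow_sub_one_ne_zero (f := f) hp (by omega)
    rw [show (p : ℚ) ^ i * ((-a : ℤ) : ℚ) / ((p : ℚ) ^ f - 1) =
      -((p : ℚ) ^ i * (a : ℤ) / ((p : ℚ) ^ f - 1)) by push_cast; ring, Int.fract_neg]
    · ring
    · intro h
      obtain ⟨z, hz⟩ := Int.fract_eq_zero_iff.mp h
      rw [eq_comm, div_eq_iff h0, ← cast_pow_sub_one hp] at hz
      have hz' : (p : ℤ) ^ i * a = z * ((p ^ f - 1 : ℕ) : ℤ) := by exact_mod_cast hz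
      apply ha
      have hco : IsCoprime ((p ^ f - 1 : ℕ) : ℤ) ((p : ℤ) ^ i) := by
        apply IsCoprime.pow_right
        -- Bézout relation `-(p ^ f - 1) + p ^ (f - 1) * p = 1`.
        refine ⟨-1, p ^ (f - 1), ?_⟩
        rw [Nat.cast_sub (Nat.one_le_pow _ _ (by omega)), ← pow_succ,
          Nat.sub_add_cancel (by omega)]
        push_cast; ring
      exact hco.dvd_of_dvd_mul_left ⟨z, by rw [hz', mul_comm]⟩
  rw [Finset.sum_congr rfl this]
  simp

end FractSum

/-! ### Valuations of Gauss and Jacobi sums -/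

section FiniteFieldSums

variable {k : Type*} [Field k] [Fintype k]

theorem sum_inv_pow_eq_zero {n : ℕ} (hn : n < Fintype.card k - 1) : ∑ x : k, (x⁻¹) ^ n = 0 := by
  rw [← FiniteField.sum_pow_lt_card_sub_one k n hn]
  exact Equiv.sum_comp (Equiv.inv k) (fun x => x ^ n)

/-- Induction through the partial fraction `x⁻¹ (1 - x)⁻¹ = x⁻¹ + (1 - x)⁻¹`. The extra power sum
over `x ≠ 0` vanishes, and removing `x = 1` from it contributes `-1` at each step. The point `0` is
left out because `0⁻¹ ^ 0 = 1`. -/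
theorem sum_inv_pow_mul_inv_one_sub [DecidableEq k] {n : ℕ} (hn : n + 1 < Fintype.card k - 1) :
    ∑ x ∈ Finset.univ.erase (0 : k), (x⁻¹) ^ n * (1 - x)⁻¹ = -((n : k) + 1) := by
  induction n with
  | zero =>
    have h1 : ∑ x : k, (1 - x)⁻¹ = 0 := by
      rw [← sum_inv_pow_eq_zero (k := k) (n := 1) (by omega)]
      simpa using Equiv.sum_comp (Equiv.subLeft (1 : k)) (fun x => x⁻¹)
    rw [← Finset.add_sum_erase _ _ (Finset.mem_univ (0 : k))] at h1
    simp only [sub_zero, inv_one] at h1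
    simp only [pow_zero, one_mul, Nat.cast_zero, zero_add]
    linear_combination h1
  | succ n ih =>
    have ih := ih (by omega)
    have h1 := sum_inv_pow_eq_zero (k := k) (n := n + 1) (by omega)
    rw [← Finset.add_sum_erase _ _ (Finset.mem_univ (0 : k))] at h1
    simp only [inv_zero, ne_eq, Nat.succ_ne_zero, not_false_eq_true, zero_pow, zero_add] at h1
    have hmem : (1 : k) ∈ Finset.univ.erase (0 : k) := by simp
    rw [← Finset.add_sum_erase _ _ hmem] at h1 ih ⊢
    simp only [inv_one, one_pow, sub_self, inv_zero, mul_zero, zero_add] at h1 ih ⊢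
    have : ∑ x ∈ (Finset.univ.erase (0 : k)).erase 1, (x⁻¹) ^ (n + 1) * (1 - x)⁻¹ =
        ∑ x ∈ (Finset.univ.erase (0 : k)).erase 1, (x⁻¹) ^ n * (1 - x)⁻¹ +
        ∑ x ∈ (Finset.univ.erase (0 : k)).erase 1, (x⁻¹) ^ (n + 1) := by
      rw [← Finset.sum_add_distrib]
      refine Finset.sum_congr rfl fun x hx => ?_
      simp only [Finset.mem_erase, Finset.mem_univ, and_true] at hx
      have h0 := hx.2
      have h1 : 1 - x ≠ 0 := sub_ne_zero.mpr (Ne.symm hx.1)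
      have h2 : x⁻¹ * (1 - x) = x⁻¹ - 1 := by rw [mul_sub, inv_mul_cancel₀ h0, mul_one]
      rw [pow_succ]
      linear_combination -(x⁻¹) ^ n * (1 - x)⁻¹ * h2 + (x⁻¹) ^ n * x⁻¹ * mul_inv_cancel₀ h1
    rw [this, ih]
    push_cast
    linear_combination h1

/-- A nontrivial additive character that is invariant under the Frobenius automorphism. -/
theorem exists_addChar_ne_one_frobenius (p : ℕ) [Fact p.Prime] [CharP k p] {R : Type*} [CommRing R]
    [IsDomain R] {z : R} (hz : IsPrimitiveRoot z p) :
    ∃ ψ : AddChar k R, ψ ≠ 1 ∧ ∀ x, ψ (x ^ p) = ψ x := by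
  obtain rfl := ringChar.eq k p
  let _ : Algebra (ZMod (ringChar k)) k := ZMod.algebra _ _
  let ψ₀ := AddChar.zmodChar (ringChar k) hz.pow_eq_one
  have hψ₀ : ψ₀.IsPrimitive := AddChar.zmodChar_primitive_of_primitive_root _ hz
  -- The character is the trace to the prime field followed by a primitive character there; the
  -- trace is Frobenius-invariant.
  refine ⟨ψ₀.compAddMonoidHom (Algebra.trace (ZMod (ringChar k)) k).toAddMonoidHom, ?_, ?_⟩
  · obtain ⟨a, ha⟩ := FiniteField.trace_to_zmod_nondegenerate k (one_ne_zero (α := k))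
    rw [one_mul] at ha
    exact AddChar.ne_one_iff.2
      ⟨a, fun hf => ha <| (hψ₀.zmod_char_eq_one_iff _ <| Algebra.trace (ZMod _) k a).mp hf⟩
  · intro x
    have := Algebra.trace_eq_of_algEquiv
      (FiniteField.frobeniusAlgEquivOfAlgebraic (ZMod (ringChar k)) k) x
    rw [FiniteField.coe_frobeniusAlgEquivOfAlgebraic, ZMod.card] at this
    simp only [AddChar.compAddMonoidHom_apply]
    exact congrArg ψ₀ this

theorem gaussSum_pow_char (p : ℕ) [Fact p.Prime] [CharP k p] {R : Type*} [CommRing R]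
    {ψ : AddChar k R} (hψ : ∀ x, ψ (x ^ p) = ψ x) (χ : MulChar k R) :
    gaussSum (χ ^ p) ψ = gaussSum χ ψ := by
  rw [gaussSum, gaussSum]
  refine Fintype.sum_bijective (frobenius k p) (bijective_frobenius k p) _ _ fun x => ?_
  rw [frobenius_def, hψ, MulChar.pow_apply' _ (Fact.out : p.Prime).ne_zero, map_pow]

end FiniteFieldSums

/-! ### The inverse Teichmüller character -/

section Teichmuller

variable {k : Type*} [Field k] [Fintype k] {R : Type*} [CommRing R] (P : Ideal R)

/-- `θ` is the inverse of the Teichmüller character: `θ x` lifts `x⁻¹`. -/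
def IsInvTeichmuller (κ : k →+* R ⧸ P) (θ : MulChar k R) : Prop :=
  ∀ x, x ≠ 0 → Ideal.Quotient.mk P (θ x) = κ x⁻¹

variable {P} {κ : k →+* R ⧸ P} {θ : MulChar k R}

/-- A power of `θ` that is trivial stays trivial after reduction, where it is a power map on the
cyclic group `kˣ`. -/
theorem IsInvTeichmuller.dvd_of_zpow_eq_one [Nontrivial (R ⧸ P)] (hθ : IsInvTeichmuller P κ θ)
    {a : ℤ} (h : θ ^ a = 1) : ((Fintype.card k - 1 : ℕ) : ℤ) ∣ a := by
  have hnat : ∀ n : ℕ, θ ^ n = 1 → Fintype.card k - 1 ∣ n := by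
    intro n hn
    rw [← FiniteField.forall_pow_eq_one_iff k]
    intro x
    have h1 : (θ ^ n) x = 1 := by rw [hn, MulChar.one_apply_coe]
    rw [MulChar.pow_apply_coe] at h1
    have h2 := congrArg (Ideal.Quotient.mk P) h1
    rw [map_pow, hθ _ x.ne_zero, ← map_pow, map_one, map_eq_one_iff _ κ.injective, inv_pow,
      inv_eq_one] at h2
    ext
    simpa using h2
  rcases Int.eq_nat_or_neg a with ⟨n, rfl | rfl⟩
  · rw [zpow_natCast] at h
    exact_mod_cast hnat n h
  · rw [zpow_neg, zpow_natCast, inv_eq_one] at h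
    rw [dvd_neg]
    exact_mod_cast hnat n h

theorem zpow_eq_of_dvd_sub {G : Type*} [Group G] {g : G} {n : ℕ} (hg : g ^ n = 1) {a b : ℤ}
    (h : (n : ℤ) ∣ a - b) : g ^ a = g ^ b := by
  obtain ⟨c, hc⟩ := h
  rw [show a = b + n * c by linarith, zpow_add, zpow_mul, zpow_natCast, hg, one_zpow, mul_one]

theorem MulChar.pow_card_sub_one_eq_one (θ : MulChar k R) : θ ^ (Fintype.card k - 1) = 1 := by
  classical
  have := θ.pow_card_eq_one
  rwa [Fintype.card_units] at this

/-- Modulo `P` the Jacobi sum becomes the power sum `∑ x⁻ⁿ (1 - x)⁻¹`. It supplies the unit in the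
induction on Gauss sums. -/
theorem IsInvTeichmuller.mk_jacobiSum (hθ : IsInvTeichmuller P κ θ) {n : ℕ} (hn0 : n ≠ 0)
    (hn : n + 1 < Fintype.card k - 1) :
    Ideal.Quotient.mk P (jacobiSum (θ ^ n) θ) = -((n : R ⧸ P) + 1) := by
  classical
  have h : ∀ x : k, Ideal.Quotient.mk P ((θ ^ n) x * θ (1 - x)) = κ ((x⁻¹) ^ n * (1 - x)⁻¹) := by
    intro x
    rcases eq_or_ne x 0 with rfl | h0
    · simp [hn0, MulChar.map_zero]
    rcases eq_or_ne x 1 with rfl | h1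
    · simp [MulChar.map_zero]
    rw [map_mul, MulChar.pow_apply' _ hn0, map_pow, hθ x h0, hθ _ (sub_ne_zero.mpr h1.symm),
      map_mul, map_pow]
  rw [jacobiSum, map_sum, Finset.sum_congr rfl fun x _ => h x, ← map_sum,
    ← Finset.add_sum_erase _ _ (Finset.mem_univ (0 : k)), sum_inv_pow_mul_inv_one_sub hn]
  simp [hn0]

end Teichmuller

/-! ### Stickelberger's theorem by induction on the exponent -/

section Valuation

open IsDedekindDomain

variable {k : Type*} [Field k] [Fintype k] {R : Type*} [CommRing R] [IsDedekindDomain R]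
  (w : HeightOneSpectrum R) {κ : k →+* R ⧸ w.asIdeal} {θ : MulChar k R}
  {p f : ℕ} [Fact p.Prime] [CharP k p] {ψ : AddChar k R}

/-- The exponents of the valuations of Gauss sums (multiplicative form). -/
theorem intValuation_gaussSum_natCast (hθ : IsInvTeichmuller w.asIdeal κ θ)
    (hcard : Fintype.card k = p ^ f) (hf : 2 < p ^ f) (hψ1 : ψ ≠ 1)
    (hψ : ∀ x, ψ (x ^ p) = ψ x) (n : ℕ) (hn : n < p ^ f - 1) :
    ∃ d : ℕ, (d : ℚ) = ((p : ℚ) - 1) * fractSum p f n ∧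
      w.intValuation (gaussSum (θ ^ n) ψ) = w.intValuation (gaussSum θ ψ) ^ d := by
  have hp : 1 < p := (Fact.out : p.Prime).one_lt
  have hf0 : f ≠ 0 := by rintro rfl; simp at hf
  have hp1 : (p : ℚ) - 1 ≠ 0 := by
    have : (1 : ℚ) < p := by exact_mod_cast hp
    linarith
  induction n using Nat.strong_induction_on with
  | _ n ih =>
    rcases Nat.eq_zero_or_pos n with rfl | hn0
    · refine ⟨0, by simp [fractSum], ?_⟩
      rw [pow_zero, pow_zero, gaussSum_one_left hψ1, Valuation.map_neg, map_one]
    by_cases hpn : p ∣ n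
    · obtain ⟨m, rfl⟩ := hpn
      have hm : 0 < m := Nat.pos_of_mul_pos_left hn0
      have hlt : m < p * m := by nlinarith
      obtain ⟨d, hd1, hd2⟩ := ih m hlt (by omega)
      refine ⟨d, ?_, ?_⟩
      · push_cast
        rw [fractSum_mul hp hf0, hd1]
      · rw [mul_comm, pow_mul, gaussSum_pow_char p hψ, hd2]
    · obtain ⟨m, rfl⟩ := Nat.exists_eq_add_one_of_ne_zero hn0.ne'
      obtain ⟨d, hd1, hd2⟩ := ih m (by omega) (by omega)
      refine ⟨d + 1, ?_, ?_⟩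
      · push_cast
        rw [fractSum_succ hp hn hpn, mul_add, ← hd1, fractSum_one hp hf, mul_one_div_cancel hp1]
      -- The congruence for the Jacobi sum needs a nonzero exponent, so `θ ^ 0 = 1` is treated
      -- apart.
      · rcases Nat.eq_zero_or_pos m with rfl | hm
        · rw [pow_zero, gaussSum_one_left hψ1, Valuation.map_neg, map_one] at hd2
          rw [pow_succ _ d, ← hd2]; simp
        have hne : θ ^ m * θ ≠ 1 := by
          intro h
          rw [← pow_succ, ← zpow_natCast] at h
          have := hθ.dvd_of_zpow_eq_one h
          rw [hcard] at this
          exact absurd (Nat.le_of_dvd (by omega) (Int.natCast_dvd_natCast.mp this)) (by omega)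
        have h1 := jacobiSum_mul_nontrivial hne ψ
        have hJ : w.intValuation (jacobiSum (θ ^ m) θ) = 1 := by
          rw [HeightOneSpectrum.intValuation_eq_one_iff, ← Ideal.Quotient.eq_zero_iff_mem,
            hθ.mk_jacobiSum hm.ne' (by omega), neg_eq_zero]
          intro h0
          apply hpn
          rw [← CharP.cast_eq_zero_iff k p, ← map_eq_zero_iff _ κ.injective]
          push_cast
          rw [← h0]; simp
        have h2 := congrArg w.intValuation h1
        rw [map_mul, map_mul, hJ, mul_one, ← pow_succ] at h2
        rw [h2, hd2, pow_succ]

theorem intValuation_gaussSum_zpow (hθ : IsInvTeichmuller w.asIdeal κ θ)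
    (hcard : Fintype.card k = p ^ f) (hf : 2 < p ^ f) (hψ1 : ψ ≠ 1)
    (hψ : ∀ x, ψ (x ^ p) = ψ x) (a : ℤ) :
    ∃ d : ℕ, (d : ℚ) = ((p : ℚ) - 1) * fractSum p f a ∧
      w.intValuation (gaussSum (θ ^ a) ψ) = w.intValuation (gaussSum θ ψ) ^ d := by
  have hp : 1 < p := (Fact.out : p.Prime).one_lt
  have hf0 : f ≠ 0 := by rintro rfl; simp at hf
  have hN : (0 : ℤ) < ((p ^ f - 1 : ℕ) : ℤ) := by omega
  obtain ⟨n, hn⟩ := Int.eq_ofNat_of_zero_le (Int.emod_nonneg a hN.ne')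
  have hlt := Int.emod_lt_of_pos a hN
  have hdvd : ((p ^ f - 1 : ℕ) : ℤ) ∣ a - n := by
    rw [← hn]; exact Int.dvd_self_sub_emod
  obtain ⟨d, h1, h2⟩ :=
    intValuation_gaussSum_natCast w hθ hcard hf hψ1 hψ n (by omega)
  refine ⟨d, ?_, ?_⟩
  · rw [h1, fractSum_congr hp hf0 hdvd]
  · rw [← h2, zpow_eq_of_dvd_sub (hcard ▸ θ.pow_card_sub_one_eq_one) hdvd, zpow_natCast]

/-- Normalization: `g(θ) g(θ⁻¹)` is `p ^ f` up to a unit, and the exponents for `1` and `-1` add up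
to `(p - 1) f`. Taking `f`-th roots in the value group avoids computing any ramification index. -/
theorem intValuation_gaussSum_pow (hθ : IsInvTeichmuller w.asIdeal κ θ)
    (hcard : Fintype.card k = p ^ f) (hf : 2 < p ^ f) (hψ1 : ψ ≠ 1)
    (hψ : ∀ x, ψ (x ^ p) = ψ x) :
    w.intValuation (gaussSum θ ψ) ^ (p - 1) = w.intValuation (p : R) := by
  have hp : 1 < p := (Fact.out : p.Prime).one_lt
  have hf0 : f ≠ 0 := by rintro rfl; simp at hf
  have hp1 : (p : ℚ) - 1 ≠ 0 := by
    have : (1 : ℚ) < p := by exact_mod_cast hp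
    linarith
  have hnd : ¬ ((p ^ f - 1 : ℕ) : ℤ) ∣ 1 := by
    intro h
    have := Int.le_of_dvd one_pos h
    omega
  obtain ⟨d, h1, h2⟩ := intValuation_gaussSum_zpow w hθ hcard hf hψ1 hψ (-1)
  have hd : d + 1 = (p - 1) * f := by
    have h3 := fractSum_add_neg hp hnd
    rw [fractSum_one hp hf] at h3
    have : ((d + 1 : ℕ) : ℚ) = (((p - 1) * f : ℕ) : ℚ) := by
      push_cast [Nat.cast_sub hp.le]
      rw [h1, ← h3]
      field_simp
      ring
    exact_mod_cast this
  have hθ1 : θ ≠ 1 := by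
    intro h
    apply hnd
    have := hθ.dvd_of_zpow_eq_one (a := 1) (by rw [zpow_one, h])
    rwa [hcard] at this
  have h4 := congrArg w.intValuation
    (gaussSum_mul_gaussSum_eq_card hθ1 (AddChar.IsPrimitive.of_ne_one hψ1))
  have h5 := congrArg w.intValuation (mul_gaussSum_inv_eq_gaussSum θ⁻¹ ψ)
  have hunit : w.intValuation ((θ⁻¹ : MulChar k R) (-1)) = 1 := by
    have : ((θ⁻¹ : MulChar k R) (-1)) * ((θ⁻¹ : MulChar k R) (-1)) = 1 := by
      rw [← map_mul, neg_one_mul, neg_neg, map_one]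
    have h6 := congrArg w.intValuation this
    rw [map_mul, map_one, ← pow_two] at h6
    exact (pow_left_inj₀ zero_le zero_le two_ne_zero).mp (h6.trans (one_pow 2).symm)
  rw [map_mul, hunit, one_mul] at h5
  rw [zpow_neg, zpow_one] at h2
  rw [map_mul, h5, h2, ← pow_succ', hd, hcard, pow_mul, Nat.cast_pow, map_pow] at h4
  exact (pow_left_inj₀ zero_le zero_le hf0).mp h4

/-- Stickelberger's theorem for Jacobi sums of powers of the inverse Teichmüller character. -/
theorem intValuation_jacobiSum (hp0 : (p : R) ≠ 0) (hθ : IsInvTeichmuller w.asIdeal κ θ)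
    (hcard : Fintype.card k = p ^ f) (hf : 2 < p ^ f) (hψ1 : ψ ≠ 1)
    (hψ : ∀ x, ψ (x ^ p) = ψ x) {a b : ℤ} (hab : ¬ ((p ^ f - 1 : ℕ) : ℤ) ∣ a + b) {n : ℕ}
    (hn : (n : ℚ) = fractSum p f a + fractSum p f b - fractSum p f (a + b)) :
    w.intValuation (jacobiSum (θ ^ a) (θ ^ b)) = w.intValuation (p : R) ^ n := by
  have hp : 1 < p := (Fact.out : p.Prime).one_lt
  have hG := intValuation_gaussSum_pow w hθ hcard hf hψ1 hψ
  have hne : θ ^ a * θ ^ b ≠ 1 := by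
    intro h
    rw [← zpow_add] at h
    apply hab
    have := hθ.dvd_of_zpow_eq_one h
    rwa [hcard] at this
  obtain ⟨d₁, h1, h1'⟩ := intValuation_gaussSum_zpow w hθ hcard hf hψ1 hψ a
  obtain ⟨d₂, h2, h2'⟩ := intValuation_gaussSum_zpow w hθ hcard hf hψ1 hψ b
  obtain ⟨d₃, h3, h3'⟩ := intValuation_gaussSum_zpow w hθ hcard hf hψ1 hψ (a + b)
  have hd : d₁ + d₂ = d₃ + (p - 1) * n := by
    have : ((d₁ + d₂ : ℕ) : ℚ) = ((d₃ + (p - 1) * n : ℕ) : ℚ) := by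
      push_cast [Nat.cast_sub hp.le]
      rw [h1, h2, h3, hn]; ring
    exact_mod_cast this
  have h := congrArg w.intValuation (jacobiSum_mul_nontrivial hne ψ)
  rw [map_mul, map_mul, ← zpow_add, h1', h2', h3', ← pow_add, hd, pow_add, pow_mul, hG] at h
  refine mul_left_cancel₀ (pow_ne_zero _ ?_) h
  intro h0
  rw [h0, zero_pow (by omega)] at hG
  exact w.intValuation_ne_zero _ hp0 hG.symm

end Valuation

/-! ### The valuation at `L` of the Jacobi sums of the power residue symbol -/

section NumberField

open IsDedekindDomain

/-- Roots of unity of order prime to the norm of `P` are separated by reduction; this identifies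
characters from their residues. -/
theorem eq_of_mk_eq_of_pow_eq_one {M : Type*} [Field M] [NumberField M] {P : Ideal (𝓞 M)}
    (hP : Ideal.absNorm P ≠ 1) {n : ℕ} [NeZero n] (hco : (Ideal.absNorm P).Coprime n)
    {x y : 𝓞 M} (hx : x ^ n = 1) (hy : y ^ n = 1)
    (h : Ideal.Quotient.mk P x = Ideal.Quotient.mk P y) : x = y := by
  have := @Ideal.rootsOfUnityMapQuot_injective M _ P _ n _ hP hco
    (rootsOfUnity.mkOfPowEq x hx) (rootsOfUnity.mkOfPowEq y hy) (by ext1; exact h)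
  exact congrArg (fun z : rootsOfUnity n (𝓞 M) => ((z : (𝓞 M)ˣ) : 𝓞 M)) this

theorem exists_isInvTeichmuller {M : Type*} [Field M] [NumberField M] {P : Ideal (𝓞 M)}
    [P.IsPrime] (hP : Ideal.absNorm P ≠ 1) {k : Type*} [Field k] [Fintype k]
    (hco : (Ideal.absNorm P).Coprime (Fintype.card k - 1)) {z : 𝓞 M}
    (hz : IsPrimitiveRoot z (Fintype.card k - 1)) (κ : k →+* 𝓞 M ⧸ P) :
    ∃ θ : MulChar k (𝓞 M), IsInvTeichmuller P κ θ := by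
  classical
  have : NeZero (Fintype.card k - 1) :=
    ⟨by have := Fintype.one_lt_card (α := k); omega⟩
  obtain ⟨g, hg⟩ := IsCyclic.exists_generator (α := kˣ)
  have hz' := hz.idealQuotient_mk hP hco
  obtain ⟨i, -, hi⟩ := hz'.eq_pow_of_pow_eq_one (ξ := κ (g : k)⁻¹) (by
    rw [← map_pow, FiniteField.pow_card_sub_one_eq_one _ (inv_ne_zero g.ne_zero), map_one])
  let u : rootsOfUnity (Fintype.card kˣ) (𝓞 M) :=
    rootsOfUnity.mkOfPowEq (n := Fintype.card kˣ) (z ^ i) (by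
      rw [Fintype.card_units, ← pow_mul, mul_comm, pow_mul, hz.pow_eq_one, one_pow])
  have hu : MulChar.ofRootOfUnity u.2 hg g = z ^ i := MulChar.ofRootOfUnity_spec u.2 hg
  -- A generator `g` of `kˣ` is sent to the power of `z` lifting `κ g⁻¹`; multiplicativity settles
  -- all other elements.
  refine ⟨MulChar.ofRootOfUnity u.2 hg, fun x hx => ?_⟩
  obtain ⟨j, hj⟩ := mem_powers_iff_mem_zpowers.mpr (hg (Units.mk0 x hx))
  have hj' : (g : k) ^ j = x := by simpa using congrArg Units.val hj
  rw [← hj', map_pow, map_pow, hu, map_pow, hi, ← map_pow, inv_pow]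

/-- A prime not dividing `m` is unramified in `ℚ(ζ_m)`. -/
theorem intValuation_natCast_eq_exp_neg_one {K : Type*} [Field K] [NumberField K] (m : ℕ)
    [NeZero m] [IsCyclotomicExtension {m} ℚ K] {p : ℕ} [hp : Fact p.Prime] (hpm : ¬ p ∣ m)
    (v : HeightOneSpectrum (𝓞 K)) [v.asIdeal.LiesOver (Ideal.span {(p : ℤ)})] :
    v.intValuation (p : 𝓞 K) = WithZero.exp (-1 : ℤ) := by
  have hp0 : (p : ℤ) ≠ 0 := by exact_mod_cast hp.out.ne_zero
  have hb : Ideal.span {(p : ℤ)} ≠ ⊥ := by simpa using hp.out.ne_zero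
  let u : HeightOneSpectrum ℤ := ⟨Ideal.span {(p : ℤ)},
    (Ideal.span_singleton_prime hp0).mpr (Nat.prime_iff_prime_int.mp hp.out), hb⟩
  have : v.asIdeal.LiesOver u.asIdeal := ‹_›
  have h := HeightOneSpectrum.intValuation_liesOver u v (p : ℤ)
  rw [Ideal.ramificationIdx'_eq_ramificationIdx _ _ hb,
    IsCyclotomicExtension.Rat.ramificationIdx_eq_of_not_dvd p K v.asIdeal hpm, pow_one,
    u.intValuation_singleton hp0 rfl] at h
  simpa using h.symm

theorem card_eq_pow_orderOf {K : Type*} [Field K] [NumberField K] {m : ℕ}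
    [NeZero m] [IsCyclotomicExtension {m} ℚ K] {p : ℕ} [Fact p.Prime] (hpm : ¬ p ∣ m)
    (L : Ideal (𝓞 K)) [L.IsPrime] [L.LiesOver (Ideal.span {(p : ℤ)})] :
    Ideal.absNorm L = p ^ orderOf (p : ZMod m) := by
  rw [← Ideal.pow_inertiaDeg p L, IsCyclotomicExtension.Rat.inertiaDeg_eq_of_not_dvd p K L hpm]

theorem fractSum_mul_div {p f m e : ℕ} (hp : 1 < p) (hf : f ≠ 0) (he : m * e = p ^ f - 1) (a : ℤ) :
    fractSum p f (a * e) = ∑ i ∈ Finset.range f, Int.fract ((p : ℚ) ^ i * a / m) := by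
  refine Finset.sum_congr rfl fun i _ => ?_
  have h := cast_pow_sub_one (f := f) hp
  have h0 := pow_sub_one_ne_zero (p := p) (f := f) hp hf
  rw [← he] at h
  rw [← h] at h0 ⊢
  push_cast at h0 ⊢
  have h1 := left_ne_zero_of_mul h0
  have h2 := right_ne_zero_of_mul h0
  congr 1
  field_simp

/-- Above `v`, in an extension with enough roots of unity, `χ` becomes `θ ^ (-e)`, and the result
for `θ` descends to `v`. -/
theorem intValuation_jacobiSum_residueChar {K : Type*} [Field K] [NumberField K]
    {p f m e : ℕ} [NeZero m] [hp : Fact p.Prime] (hm : 1 < m)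
    (v : HeightOneSpectrum (𝓞 K)) [v.asIdeal.LiesOver (Ideal.span {(p : ℤ)})]
    {k : Type*} [Field k] [Fintype k] (hcard : Fintype.card k = p ^ f) (he : m * e = p ^ f - 1)
    (κ₀ : k →+* 𝓞 K ⧸ v.asIdeal) {χ : MulChar k (𝓞 K)}
    (hχ : ∀ x, x ≠ 0 → χ x ^ m = 1 ∧ Ideal.Quotient.mk v.asIdeal (χ x) = κ₀ x ^ e)
    {b c : ℤ} (hbc : ¬ (m : ℤ) ∣ b + c) {n : ℕ}
    (hn : (n : ℚ) = ∑ i ∈ Finset.range f, (Int.fract ((p : ℚ) ^ i * (-b : ℤ) / m) +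
      Int.fract ((p : ℚ) ^ i * (-c : ℤ) / m) - Int.fract ((p : ℚ) ^ i * (-(b + c) : ℤ) / m))) :
    v.intValuation (jacobiSum (χ ^ b) (χ ^ c)) = v.intValuation (p : 𝓞 K) ^ n := by
  have hp1 := hp.out.one_lt
  have hN1 : 1 < p ^ f := hcard ▸ Fintype.one_lt_card
  have hf0 : f ≠ 0 := by rintro rfl; simp at hN1
  have he0 : e ≠ 0 := by rintro rfl; omega
  have hf : 2 < p ^ f := by
    have : 2 ≤ m * e := by
      calc 2 ≤ m * 1 := by omega
        _ ≤ m * e := Nat.mul_le_mul_left _ (by omega)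
    omega
  have : NeZero (p ^ f - 1) := ⟨by omega⟩
  have : NeZero (p * (p ^ f - 1)) := ⟨mul_ne_zero (by omega) (by omega)⟩
  have : CharP k p := by
    have : CharP k (ringChar k) := inferInstance
    obtain ⟨j, hj, hj'⟩ := FiniteField.card k (ringChar k)
    rw [hcard] at hj'
    have h : ringChar k = p := by
      have h1 : ringChar k ∣ p ^ f := hj' ▸ dvd_pow_self _ j.ne_zero
      exact (Nat.prime_dvd_prime_iff_eq hj hp.out).mp (hj.dvd_of_dvd_pow h1)
    exact h ▸ this
  have hχN : ∀ x, x ≠ 0 → χ x ^ (p ^ f - 1) = 1 := fun x hx => by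
    rw [← he, pow_mul, (hχ x hx).1, one_pow]
  have hN : ∀ {R : Type _} [CommRing R] (θ : MulChar k R), θ ^ (p ^ f - 1) = 1 :=
    fun θ => hcard ▸ θ.pow_card_sub_one_eq_one
  -- The roots of unity of order `p` are for the additive character, those of order `p ^ f - 1` for
  -- `θ`.
  let M := CyclotomicField (p * (p ^ f - 1)) K
  have hζ := (IsCyclotomicExtension.zeta_spec (p * (p ^ f - 1)) K M).toInteger_isPrimitiveRoot
  have hz := hζ.pow (Nat.pos_of_ne_zero (NeZero.ne _)) rfl
  have hz' := hζ.pow (Nat.pos_of_ne_zero (NeZero.ne _)) (mul_comm _ _)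
  have hmax : v.asIdeal.IsMaximal := v.isMaximal
  obtain ⟨Q, hQmax, hQover⟩ :=
    Ideal.exists_maximal_ideal_liesOver_of_isIntegral (S := 𝓞 M) v.asIdeal
  let w : HeightOneSpectrum (𝓞 M) :=
    ⟨Q, inferInstance, Ideal.ne_bot_of_liesOver_of_ne_bot v.ne_bot Q⟩
  have hwv : w.asIdeal.LiesOver v.asIdeal := hQover
  have hwp : w.asIdeal.LiesOver (Ideal.span {(p : ℤ)}) := .trans _ v.asIdeal _
  have hnorm := Ideal.pow_inertiaDeg p w.asIdeal
  have hne1 : Ideal.absNorm w.asIdeal ≠ 1 :=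
    Ideal.absNorm_eq_one_iff.not.mpr (Ideal.IsPrime.ne_top inferInstance)
  have hcop : Nat.Coprime p (p ^ f - 1) := by
    rw [Nat.Prime.coprime_iff_not_dvd hp.out]
    intro h
    have h2 := (Nat.dvd_sub_iff_right hN1.le (dvd_pow_self p hf0)).mp h
    exact hp.out.one_lt.ne' (Nat.dvd_one.mp h2)
  have hco : (Ideal.absNorm w.asIdeal).Coprime (p ^ f - 1) := hnorm ▸ Nat.Coprime.pow_left _ hcop
  let κ : k →+* 𝓞 M ⧸ w.asIdeal :=
    (algebraMap (𝓞 K ⧸ v.asIdeal) (𝓞 M ⧸ w.asIdeal)).comp κ₀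
  obtain ⟨θ, hθ⟩ := exists_isInvTeichmuller hne1 (k := k) (by rwa [hcard]) (by rwa [hcard]) κ
  obtain ⟨ψ, hψ1, hψ⟩ := exists_addChar_ne_one_frobenius (k := k) p hz'
  have hχθ : χ.ringHomComp (algebraMap (𝓞 K) (𝓞 M)) = θ ^ (-(e : ℤ)) := by
    refine MulChar.ext fun x => ?_
    refine eq_of_mk_eq_of_pow_eq_one (n := p ^ f - 1) hne1 hco ?_ ?_ ?_
    · rw [MulChar.ringHomComp_apply, ← map_pow, hχN x x.ne_zero, map_one]
    · rw [← MulChar.pow_apply_coe, ← zpow_natCast, ← zpow_mul, mul_comm (-(e : ℤ)), zpow_mul,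
        zpow_natCast, hN, one_zpow, MulChar.one_apply_coe]
    · rw [MulChar.ringHomComp_apply, zpow_neg, zpow_natCast, MulChar.inv_apply',
        MulChar.pow_apply' _ he0, map_pow, hθ _ (inv_ne_zero x.ne_zero), inv_inv, RingHom.comp_apply, ← map_pow,
        ← (hχ x x.ne_zero).2]
      rfl
  have hmap : algebraMap (𝓞 K) (𝓞 M) (jacobiSum (χ ^ b) (χ ^ c)) =
      jacobiSum (θ ^ (-b * e)) (θ ^ (-c * e)) := by
    rw [← jacobiSum_ringHomComp, ← MulChar.ringHomComp_zpow, ← MulChar.ringHomComp_zpow, hχθ,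
      ← zpow_mul, ← zpow_mul]
    congr 2 <;> ring
  have key := intValuation_jacobiSum w (by exact_mod_cast hp.out.ne_zero) hθ hcard hf hψ1 hψ
    (a := -b * e) (b := -c * e) (n := n) ?_ ?_
  -- Both sides come from `𝓞 K`, so the ramification index of `w` over `v` is a common exponent and
  -- cancels.
  · rw [← hmap, ← map_natCast (algebraMap (𝓞 K) (𝓞 M)),
      ← HeightOneSpectrum.intValuation_liesOver v w, ← HeightOneSpectrum.intValuation_liesOver v w,
      ← pow_mul, mul_comm (Ideal.ramificationIdx' _ _), pow_mul] at key
    exact (pow_left_inj₀ zero_le zero_le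
      (Ideal.IsDedekindDomain.ramificationIdx'_ne_zero_of_liesOver w.asIdeal v.ne_bot)).mp key
  · intro h
    apply hbc
    rw [← he, ← add_mul, Nat.cast_mul] at h
    have := Int.dvd_of_mul_dvd_mul_right (by exact_mod_cast he0) h
    rwa [← neg_add, dvd_neg] at this
  · rw [hn, ← add_mul, ← neg_add, fractSum_mul_div hp1 hf0 he, fractSum_mul_div hp1 hf0 he,
      fractSum_mul_div hp1 hf0 he, Finset.sum_sub_distrib, Finset.sum_add_distrib]

end NumberField

namespace ShortStickelberger

/-! ### Coefficients of the Stickelberger elements -/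

section GroupRing

variable {K : Type*} [Field K] [NumberField K]

theorem toRat_coeff (α : MonoidAlgebra ℤ Gal(K/ℚ)) (σ : Gal(K/ℚ)) :
    (toRat α).coeff σ = α.coeff σ := by
  rw [toRat, MonoidAlgebra.coeff_mapRingHom]; rfl

theorem exists_isShort_of_coeff {A : MonoidAlgebra ℚ Gal(K/ℚ)}
    (hA : ∀ σ, A.coeff σ = 0 ∨ A.coeff σ = 1) :
    ∃ α : MonoidAlgebra ℤ Gal(K/ℚ), toRat α = A ∧ IsShort α := by
  classical
  have hα : ∀ σ, (∑ τ : Gal(K/ℚ), MonoidAlgebra.single τ ⌊A.coeff τ⌋).coeff σ = ⌊A.coeff σ⌋ := by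
    intro σ
    rw [MonoidAlgebra.coeff_sum, Finsupp.finsetSum_apply, Finset.sum_eq_single σ]
    · simp
    · intro τ _ h; simp [h]
    · simp
  refine ⟨∑ σ, MonoidAlgebra.single σ ⌊A.coeff σ⌋, ?_, fun σ => ?_⟩
  · apply MonoidAlgebra.ext
    ext σ
    rw [toRat_coeff, hα]
    rcases hA σ with h | h <;> simp [h]
  · rw [hα]
    rcases hA σ with h | h <;> simp [h]

variable (m : ℕ) [NeZero m] [IsCyclotomicExtension {m} ℚ K]

theorem theta_coeff (a : ℤ) (s : (ZMod m)ˣ) :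
    (theta K m a).coeff ((IsCyclotomicExtension.Rat.galEquivZMod m K).symm s)⁻¹ =
      Int.fract (-((a : ℚ) * ((s : ZMod m).val : ℚ)) / (m : ℚ)) := by
  classical
  rw [theta, MonoidAlgebra.coeff_sum, Finsupp.finsetSum_apply, Finset.sum_eq_single s]
  · simp
  · intro t _ h
    rw [MonoidAlgebra.coeff_single, Finsupp.single_eq_of_ne]
    intro hst
    exact h ((MulEquiv.injective _ (inv_injective hst)).symm)
  · simp

theorem normElt_coeff (σ : Gal(K/ℚ)) : (normElt K).coeff σ = 1 := by
  classical
  rw [normElt, MonoidAlgebra.coeff_sum, Finsupp.finsetSum_apply, Finset.sum_eq_single σ]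
  · simp
  · intro t _ h; simp [h]
  · simp

variable {m} in
theorem ext_galEquivZMod {A B : MonoidAlgebra ℚ Gal(K/ℚ)}
    (h : ∀ s : (ZMod m)ˣ, A.coeff ((IsCyclotomicExtension.Rat.galEquivZMod m K).symm s)⁻¹ =
      B.coeff ((IsCyclotomicExtension.Rat.galEquivZMod m K).symm s)⁻¹) : A = B := by
  apply MonoidAlgebra.ext
  ext σ
  have := h (IsCyclotomicExtension.Rat.galEquivZMod m K σ⁻¹)
  rwa [MulEquiv.symm_apply_apply, inv_inv] at this

theorem theta_congr {a b : ℤ} (h : (m : ℤ) ∣ a - b) : theta K m a = theta K m b := by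
  refine ext_galEquivZMod (m := m) fun s => ?_
  rw [theta_coeff, theta_coeff, Int.fract_eq_fract]
  obtain ⟨c, hc⟩ := h
  refine ⟨-c * (s : ZMod m).val, ?_⟩
  have hm : (m : ℚ) ≠ 0 := by exact_mod_cast NeZero.ne m
  have ha : (a : ℚ) = b + m * c := by
    have : a = b + m * c := by linarith
    exact_mod_cast this
  push_cast
  rw [ha]
  field_simp
  ring

/-- Coefficientwise this is `⟨x⟩ + ⟨-x⟩ = 1`; `x` is not an integer because `s` is a unit modulo
`m`. -/
theorem theta_add_neg {a : ℤ} (h : ¬ (m : ℤ) ∣ a) : theta K m a + theta K m (-a) = normElt K := by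
  refine ext_galEquivZMod (m := m) fun s => ?_
  have hm : (m : ℚ) ≠ 0 := by exact_mod_cast NeZero.ne m
  rw [MonoidAlgebra.coeff_add, Finsupp.add_apply, theta_coeff, theta_coeff, normElt_coeff,
    show -(((-a : ℤ) : ℚ) * ((s : ZMod m).val : ℚ)) / (m : ℚ) =
      -(-((a : ℚ) * ((s : ZMod m).val : ℚ)) / (m : ℚ)) by push_cast; ring, Int.fract_neg]
  · ring
  · intro h0
    obtain ⟨z, hz⟩ := Int.fract_eq_zero_iff.mp h0
    rw [eq_comm, div_eq_iff hm] at hz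
    apply h
    have hz' : a * ((s : ZMod m).val : ℤ) = (m : ℤ) * -z := by
      have : (a : ℚ) * ((s : ZMod m).val : ℚ) = m * -z := by linarith
      exact_mod_cast this
    have hco : IsCoprime (m : ℤ) ((s : ZMod m).val : ℤ) :=
      Nat.isCoprime_iff_coprime.mpr (ZMod.val_coe_unit_coprime s).symm
    exact hco.dvd_of_dvd_mul_right ⟨_, hz'⟩

/-- The expression is an integer lying strictly between `-1` and `2`. -/
theorem fract_add_sub_eq_zero_or_one (x y : ℚ) :
    Int.fract x + Int.fract y - Int.fract (x + y) = 0 ∨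
      Int.fract x + Int.fract y - Int.fract (x + y) = 1 := by
  obtain ⟨z, hz⟩ := Int.fract_add x y
  have h1 := Int.fract_nonneg x
  have h2 := Int.fract_nonneg y
  have h3 := Int.fract_nonneg (x + y)
  have h4 := Int.fract_lt_one x
  have h5 := Int.fract_lt_one y
  have h6 := Int.fract_lt_one (x + y)
  have h7 : z < 1 := by
    have : (z : ℚ) < 1 := by linarith
    exact_mod_cast this
  have h8 : -2 < z := by
    have : (-2 : ℚ) < z := by linarith
    exact_mod_cast this
  obtain rfl | rfl : z = 0 ∨ z = -1 := by omega
  · left; push_cast at hz; linarith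
  · right; push_cast at hz; linarith

theorem exists_isShort_theta (b c : ℤ) :
    ∃ α : MonoidAlgebra ℤ Gal(K/ℚ),
      toRat α = theta K m b + theta K m c - theta K m (b + c) ∧ IsShort α := by
  refine exists_isShort_of_coeff fun σ => ?_
  obtain ⟨s, rfl⟩ : ∃ s, ((IsCyclotomicExtension.Rat.galEquivZMod m K).symm s)⁻¹ = σ :=
    ⟨IsCyclotomicExtension.Rat.galEquivZMod m K σ⁻¹, by rw [MulEquiv.symm_apply_apply, inv_inv]⟩
  rw [MonoidAlgebra.coeff_sub, MonoidAlgebra.coeff_add, Finsupp.sub_apply, Finsupp.add_apply,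
    theta_coeff, theta_coeff, theta_coeff]
  convert fract_add_sub_eq_zero_or_one (-((b : ℚ) * ((s : ZMod m).val : ℚ)) / (m : ℚ))
    (-((c : ℚ) * ((s : ZMod m).val : ℚ)) / (m : ℚ)) using 4 <;> push_cast <;> ring_nf

end GroupRing

/-! ### Prime exponents of principal ideals and of `L ^ α` -/

section Valuations

open IsDedekindDomain

variable {K : Type*} [Field K] [NumberField K]

theorem intValuation_smul (v w : HeightOneSpectrum (𝓞 K)) {σ : Gal(K/ℚ)}
    (h : w.asIdeal = σ • v.asIdeal) (x : 𝓞 K) :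
    w.intValuation (σ • x) = v.intValuation x := by
  rcases eq_or_ne x 0 with rfl | hx
  · simp
  rw [w.intValuation_eq_exp_neg_multiplicity ((smul_ne_zero_iff_ne σ).mpr hx),
    v.intValuation_eq_exp_neg_multiplicity hx]
  congr 3
  refine multiplicity_eq_of_emultiplicity_eq (emultiplicity_eq_emultiplicity_iff.mpr fun n => ?_)
  rw [Ideal.dvd_span_singleton, Ideal.dvd_span_singleton, h, ← smul_pow',
    Ideal.smul_mem_pointwise_smul_iff]

theorem count_principal (v : HeightOneSpectrum (𝓞 K)) {x : 𝓞 K} {n : ℕ}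
    (h : v.intValuation x = WithZero.exp (-(n : ℤ))) :
    FractionalIdeal.count K v (principal x) = n := by
  have hx : x ≠ 0 := by
    rintro rfl
    rw [map_zero] at h
    exact WithZero.exp_ne_zero h.symm
  rw [principal, FractionalIdeal.count_coe K v (by simpa using hx)]
  rw [v.intValuation_if_neg hx, WithZero.exp_inj, neg_inj] at h
  exact h

theorem ext_count {I I' : FractionalIdeal (𝓞 K)⁰ K} (hI : I ≠ 0) (hI' : I' ≠ 0)
    (h : ∀ v : HeightOneSpectrum (𝓞 K),
      FractionalIdeal.count K v I = FractionalIdeal.count K v I') : I = I' := by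
  rw [← FractionalIdeal.finprod_heightOneSpectrum_factorization' K hI,
    ← FractionalIdeal.finprod_heightOneSpectrum_factorization' K hI']
  simp only [h]

theorem smul_ne_bot {σ : Gal(K/ℚ)} {L : Ideal (𝓞 K)} (hL : L ≠ ⊥) : σ • L ≠ ⊥ := by
  intro h
  apply hL
  rw [← Ideal.zero_eq_bot] at h ⊢
  exact (smul_eq_zero_iff_eq σ).mp h

theorem idealPow_ne_zero {L : Ideal (𝓞 K)} (hL : L ≠ ⊥) (α : MonoidAlgebra ℤ Gal(K/ℚ)) :
    idealPow L α ≠ 0 := by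
  refine Finset.prod_ne_zero_iff.mpr fun σ _ => zpow_ne_zero _ ?_
  rw [FractionalIdeal.coeIdeal_ne_zero]
  exact smul_ne_bot hL

open Classical in
-- Several `σ` may carry `L` to the same prime, so the exponent is a sum over a coset of the
-- stabilizer, or empty.
theorem count_idealPow (L v : HeightOneSpectrum (𝓞 K)) (α : MonoidAlgebra ℤ Gal(K/ℚ)) :
    FractionalIdeal.count K v (idealPow L.asIdeal α) =
      ∑ σ : Gal(K/ℚ) with σ • L.asIdeal = v.asIdeal, α.coeff σ := by
  rw [idealPow, FractionalIdeal.count_prod]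
  · rw [Finset.sum_filter]
    refine Finset.sum_congr rfl fun σ _ => ?_
    rw [FractionalIdeal.count_zpow]
    let w : HeightOneSpectrum (𝓞 K) := ⟨σ • L.asIdeal, inferInstance, smul_ne_bot L.ne_bot⟩
    have := FractionalIdeal.count_maximal K v w
    change FractionalIdeal.count K v ↑(σ • L.asIdeal) = _ at this
    rw [this]
    have h : w = v ↔ σ • L.asIdeal = v.asIdeal := HeightOneSpectrum.ext_iff
    simp only [h, mul_ite, mul_one, mul_zero]
  · intro σ _
    exact zpow_ne_zero _ (FractionalIdeal.coeIdeal_ne_zero.mpr (smul_ne_bot L.ne_bot))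

end Valuations

end ShortStickelberger

theorem MulChar.pow_eq_one_of_forall {k R : Type*} [Field k] [CommMonoidWithZero R] {m : ℕ}
    {χ : MulChar k R} (hχ : ∀ x, x ≠ 0 → χ x ^ m = 1) : χ ^ m = 1 := by
  refine MulChar.ext fun x => ?_
  rw [MulChar.pow_apply_coe, hχ x x.ne_zero, MulChar.one_apply_coe]

/-! ### Power residue characters and the product of conjugate Jacobi sums -/

section ResidueChar

variable {k : Type*} [Field k] [Fintype k] {R : Type*} [CommRing R] {P : Ideal R}
  {m e : ℕ} {κ₀ : k →+* R ⧸ P} {χ : MulChar k R}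

theorem dvd_of_residueChar_zpow_eq_one [Nontrivial (R ⧸ P)] (hm : m ≠ 0)
    (he : m * e = Fintype.card k - 1)
    (hχ : ∀ x, x ≠ 0 → χ x ^ m = 1 ∧ Ideal.Quotient.mk P (χ x) = κ₀ x ^ e) {b : ℤ}
    (h : χ ^ b = 1) : (m : ℤ) ∣ b := by
  have hm' : (0 : ℤ) < m := by omega
  obtain ⟨n, hn⟩ := Int.eq_ofNat_of_zero_le (Int.emod_nonneg b hm'.ne')
  have hdvd : (m : ℤ) ∣ b - n := hn ▸ Int.dvd_self_sub_emod
  rw [zpow_eq_of_dvd_sub (MulChar.pow_eq_one_of_forall fun x hx => (hχ x hx).1) hdvd,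
    zpow_natCast] at h
  have hen : Fintype.card k - 1 ∣ e * n := by
    rw [← FiniteField.forall_pow_eq_one_iff k]
    intro x
    have h1 : (χ ^ n) x = 1 := by rw [h, MulChar.one_apply_coe]
    rw [MulChar.pow_apply_coe] at h1
    have h2 := congrArg (Ideal.Quotient.mk P) h1
    rw [map_pow, (hχ _ x.ne_zero).2, ← map_pow, ← map_pow, map_one, map_eq_one_iff _ κ₀.injective,
      ← pow_mul] at h2
    ext
    simpa using h2
  have he0 : 0 < e := by
    rcases Nat.eq_zero_or_pos e with rfl | h
    · have := Fintype.one_lt_card (α := k); omega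
    · exact h
  rw [← he, mul_comm m] at hen
  have : (m : ℤ) ∣ n := by exact_mod_cast Nat.dvd_of_mul_dvd_mul_left he0 hen
  exact (dvd_sub_left this).mp hdvd

end ResidueChar

theorem jacobiSum_mul_jacobiSum_inv_of_charZero {k : Type*} [Field k] [Fintype k]
    (R F : Type*) [CommRing R] [Field F] [CharZero F] [Algebra R F] [FaithfulSMul R F]
    {χ φ : MulChar k R} (hχ : χ ≠ 1) (hφ : φ ≠ 1) (h : χ * φ ≠ 1) :
    jacobiSum χ φ * jacobiSum χ⁻¹ φ⁻¹ = Fintype.card k := by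
  have hinj := FaithfulSMul.algebraMap_injective R F
  have key : ∀ {ψ : MulChar k R}, ψ ≠ 1 → ψ.ringHomComp (algebraMap R F) ≠ 1 :=
    fun hψ => (MulChar.ringHomComp_ne_one_iff hinj).mpr hψ
  have hchar : ringChar F ≠ ringChar k := by
    rw [ringChar.eq_zero]
    exact (CharP.ringChar_ne_zero_of_finite k).symm
  have := jacobiSum_mul_jacobiSum_inv hchar (key hχ) (key hφ)
    (by rw [← MulChar.ringHomComp_mul]; exact key h)
  apply hinj
  rw [MulChar.ringHomComp_inv, MulChar.ringHomComp_inv, jacobiSum_ringHomComp,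
    jacobiSum_ringHomComp] at this
  rw [map_mul, this, map_natCast]

/-- The index set is the coset of `ρ` modulo the cyclic stabilizer. Its elements are listed through
inverse powers of `g` to match the `σ_s⁻¹` in `θ_m`. -/
theorem sum_filter_smul_eq_sum_range {G X M : Type*} [Group G] [Fintype G] [MulAction G X]
    [DecidableEq X] [AddCommMonoid M] (x : X) (ρ g : G)
    (hg : MulAction.stabilizer G x = Subgroup.zpowers g) (F : G → M) :
    ∑ σ : G with σ • x = ρ • x, F σ = ∑ i ∈ Finset.range (orderOf g), F (ρ * (g ^ i)⁻¹) := by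
  symm
  refine Finset.sum_bij (fun i _ => ρ * (g ^ i)⁻¹) ?_ ?_ ?_ ?_
  · intro i _
    rw [Finset.mem_filter, mul_smul]
    refine ⟨Finset.mem_univ _, ?_⟩
    congr 1
    rw [← MulAction.mem_stabilizer_iff, hg]
    exact inv_mem (pow_mem (Subgroup.mem_zpowers g) i)
  · intro i hi j hj h
    have := inv_injective (mul_left_cancel h)
    exact pow_injOn_Iio_orderOf (by simpa using hi) (by simpa using hj) this
  · intro σ hσ
    have h1 : (ρ⁻¹ * σ)⁻¹ ∈ Subgroup.zpowers g := by
      rw [← hg]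
      refine inv_mem ?_
      rw [MulAction.mem_stabilizer_iff, mul_smul, (Finset.mem_filter.mp hσ).2, inv_smul_smul]
    rw [← mem_powers_iff_mem_zpowers] at h1
    obtain ⟨i, hi⟩ := h1
    have hi' : g ^ i = (ρ⁻¹ * σ)⁻¹ := hi
    refine ⟨i % orderOf g, Finset.mem_range.mpr (Nat.mod_lt _ (orderOf_pos g)), ?_⟩
    rw [pow_mod_orderOf, hi', inv_inv, mul_inv_cancel_left]
  · intro i _; rfl

namespace ShortStickelberger

open IsDedekindDomain

theorem absNorm_coprime {K : Type*} [Field K] [NumberField K] {m ℓ : ℕ} (hℓm : ℓ.Coprime m) (L : Ideal (𝓞 K)) [L.IsMaximal]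
    [L.LiesOver (Ideal.span {(ℓ : ℤ)})] : (Ideal.absNorm L).Coprime m :=
  Ideal.pow_inertiaDeg ℓ L ▸ Nat.Coprime.pow_left _ hℓm

/-! ### Galois action on the Jacobi sums -/

section PowerResidue

variable {K : Type*} [Field K] [NumberField K] {m : ℕ} [NeZero m] [IsCyclotomicExtension {m} ℚ K]

theorem powerResidueSymbol_pow_eq_one (L : Ideal (𝓞 K)) [L.IsMaximal]
    (hL : (Ideal.absNorm L).Coprime m) : powerResidueSymbol m L ^ m = 1 := by
  refine MulChar.ext fun x => ?_
  rw [MulChar.pow_apply_coe, (powerResidueSymbol_spec m L hL x).1, MulChar.one_apply_coe]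

theorem jacobi_congr (L : Ideal (𝓞 K)) [L.IsMaximal] (hL : (Ideal.absNorm L).Coprime m)
    {b c b' c' : ℤ} (hb : (m : ℤ) ∣ b - b') (hc : (m : ℤ) ∣ c - c') :
    jacobi m b c L = jacobi m b' c' L := by
  have h := powerResidueSymbol_pow_eq_one L hL
  rw [jacobi, jacobi, zpow_eq_of_dvd_sub h hb, zpow_eq_of_dvd_sub h hc]

/-- `σ_s` raises the values of `χ_L`, which are `m`-th roots of unity, to the power `s`. -/
theorem smul_jacobi (L : Ideal (𝓞 K)) [L.IsMaximal] (hL : (Ideal.absNorm L).Coprime m)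
    (s : (ZMod m)ˣ) (b c : ℤ) :
    (IsCyclotomicExtension.Rat.galEquivZMod m K).symm s • jacobi m b c L =
      jacobi m ((s : ZMod m).val * b) ((s : ZMod m).val * c) L := by
  let _ : Fintype (𝓞 K ⧸ L) := Fintype.ofFinite _
  set σ := (IsCyclotomicExtension.Rat.galEquivZMod m K).symm s with hσ
  have hs : IsCyclotomicExtension.Rat.galEquivZMod m K σ = s := MulEquiv.apply_symm_apply _ _
  have h : (powerResidueSymbol m L).ringHomComp (MulSemiringAction.toRingHom _ (𝓞 K) σ) =
      powerResidueSymbol m L ^ (s : ZMod m).val := by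
    refine MulChar.ext fun x => ?_
    rw [MulChar.ringHomComp_apply, MulSemiringAction.toRingHom_apply,
      IsCyclotomicExtension.Rat.galEquivZMod_smul_of_pow_eq m K σ
      (powerResidueSymbol_spec m L hL x).1, hs, MulChar.pow_apply_coe]
  rw [jacobi, jacobi, smul_neg, ← MulSemiringAction.toRingHom_apply, ← jacobiSum_ringHomComp,
    ← MulChar.ringHomComp_zpow, ← MulChar.ringHomComp_zpow, h, zpow_mul, zpow_mul, zpow_natCast]

end PowerResidue

open IsDedekindDomain

theorem orderOf_unitOfCoprime {m ℓ : ℕ} (hℓm : ℓ.Coprime m) :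
    orderOf (ZMod.unitOfCoprime ℓ hℓm) = orderOf (ℓ : ZMod m) := by
  rw [← orderOf_injective _ Units.coeHom_injective, Units.coeHom_apply, ZMod.coe_unitOfCoprime]

/-- The chosen representative of `s ℓ ^ i` modulo `m` may be replaced by the product itself, turning
coefficients of `θ_m` into the terms of the valuation formula. -/
theorem fract_val_mul {m ℓ : ℕ} [NeZero m] (hℓm : ℓ.Coprime m) (s : (ZMod m)ˣ) (i : ℕ) (a : ℤ) :
    Int.fract (-((a : ℚ) * (((s * ZMod.unitOfCoprime ℓ hℓm ^ i : (ZMod m)ˣ) : ZMod m).val : ℚ)) /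
      (m : ℚ)) = Int.fract ((ℓ : ℚ) ^ i * (-((s : ZMod m).val * a) : ℤ) / m) := by
  rw [Int.fract_eq_fract]
  have h : (m : ℤ) ∣ (s : ZMod m).val * ℓ ^ i -
      (((s * ZMod.unitOfCoprime ℓ hℓm ^ i : (ZMod m)ˣ) : ZMod m).val : ℤ) := by
    rw [← ZMod.intCast_zmod_eq_zero_iff_dvd]
    push_cast
    rw [ZMod.natCast_zmod_val, ZMod.natCast_zmod_val, ZMod.coe_unitOfCoprime, sub_self]
  obtain ⟨z, hz⟩ := h
  refine ⟨a * z, ?_⟩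
  have hm : (m : ℚ) ≠ 0 := by exact_mod_cast NeZero.ne m
  have hz' : ((s : ZMod m).val : ℚ) * ℓ ^ i -
      (((s * ZMod.unitOfCoprime ℓ hℓm ^ i : (ZMod m)ˣ) : ZMod m).val : ℚ) = m * z := by
    exact_mod_cast hz
  rw [div_sub_div_same, div_eq_iff hm]
  push_cast at hz' ⊢
  linear_combination (a : ℚ) * hz'

/-! ### Factorization of `J(b, c, L)` -/

section MainFactorization

variable {K : Type*} [Field K] [NumberField K] {m : ℕ} [NeZero m] [IsCyclotomicExtension {m} ℚ K]
  {ℓ : ℕ} [hℓ : Fact ℓ.Prime]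

theorem mul_div_eq_pow_orderOf_sub_one {m ℓ : ℕ} (hℓ : 0 < ℓ) :
    m * ((ℓ ^ orderOf (ℓ : ZMod m) - 1) / m) = ℓ ^ orderOf (ℓ : ZMod m) - 1 := by
  refine Nat.mul_div_cancel' ?_
  rw [← ZMod.natCast_eq_zero_iff, Nat.cast_sub (Nat.one_le_pow _ _ hℓ)]
  push_cast
  rw [pow_orderOf_eq_one, sub_self]

theorem powerResidueSymbol_apply (hℓm : ℓ.Coprime m) (L : Ideal (𝓞 K)) [L.IsMaximal]
    [L.LiesOver (Ideal.span {(ℓ : ℤ)})] (x : 𝓞 K ⧸ L) (hx : x ≠ 0) :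
    powerResidueSymbol m L x ^ m = 1 ∧ Ideal.Quotient.mk L (powerResidueSymbol m L x) =
      x ^ ((ℓ ^ orderOf (ℓ : ZMod m) - 1) / m) := by
  let _ : Field (𝓞 K ⧸ L) := Ideal.Quotient.field L
  have h := powerResidueSymbol_spec m L (absNorm_coprime hℓm L) (Units.mk0 x hx)
  rwa [card_eq_pow_orderOf ((Nat.Prime.coprime_iff_not_dvd hℓ.out).mp hℓm)] at h

theorem card_quotient_eq (hℓm : ℓ.Coprime m) (L : Ideal (𝓞 K)) [L.IsMaximal]
    [L.LiesOver (Ideal.span {(ℓ : ℤ)})] [Fintype (𝓞 K ⧸ L)] :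
    Fintype.card (𝓞 K ⧸ L) = ℓ ^ orderOf (ℓ : ZMod m) := by
  rw [← card_eq_pow_orderOf ((Nat.Prime.coprime_iff_not_dvd hℓ.out).mp hℓm) L,
    Fintype.card_eq_nat_card]
  rfl

theorem jacobi_mul_jacobi_neg (hm : 1 < m) (hℓm : ℓ.Coprime m) (L : Ideal (𝓞 K)) [L.IsMaximal]
    [L.LiesOver (Ideal.span {(ℓ : ℤ)})] {b c : ℤ} (hb : ¬ (m : ℤ) ∣ b) (hc : ¬ (m : ℤ) ∣ c)
    (hbc : ¬ (m : ℤ) ∣ b + c) :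
    jacobi m b c L * jacobi m (-b) (-c) L = (ℓ : 𝓞 K) ^ orderOf (ℓ : ZMod m) := by
  let _ : Field (𝓞 K ⧸ L) := Ideal.Quotient.field L
  let _ : Fintype (𝓞 K ⧸ L) := Fintype.ofFinite _
  have key : ∀ a : ℤ, ¬ (m : ℤ) ∣ a → powerResidueSymbol m L ^ a ≠ 1 := fun a ha h => by
    refine ha (dvd_of_residueChar_zpow_eq_one (P := L) (κ₀ := RingHom.id _) (by omega)
      ?_ (powerResidueSymbol_apply hℓm L) h)
    rw [card_quotient_eq hℓm L, mul_div_eq_pow_orderOf_sub_one hℓ.out.pos]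
  have h := jacobiSum_mul_jacobiSum_inv_of_charZero (𝓞 K) K (key b hb) (key c hc)
    (by rw [← zpow_add]; exact key _ hbc)
  rw [jacobi, jacobi, neg_mul_neg, zpow_neg, zpow_neg, ← Nat.cast_pow, ← card_quotient_eq hℓm L]
  exact h

theorem intValuation_jacobi (hm : 1 < m) (hℓm : ℓ.Coprime m) (v : HeightOneSpectrum (𝓞 K))
    [v.asIdeal.IsMaximal] [v.asIdeal.LiesOver (Ideal.span {(ℓ : ℤ)})] {b c : ℤ}
    (hbc : ¬ (m : ℤ) ∣ b + c) {n : ℕ}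
    (hn : (n : ℚ) = ∑ i ∈ Finset.range (orderOf (ℓ : ZMod m)),
      (Int.fract ((ℓ : ℚ) ^ i * (-b : ℤ) / m) + Int.fract ((ℓ : ℚ) ^ i * (-c : ℤ) / m) -
        Int.fract ((ℓ : ℚ) ^ i * (-(b + c) : ℤ) / m))) :
    v.intValuation (jacobi m b c v.asIdeal) = WithZero.exp (-(n : ℤ)) := by
  let _ : Field (𝓞 K ⧸ v.asIdeal) := Ideal.Quotient.field v.asIdeal
  let _ : Fintype (𝓞 K ⧸ v.asIdeal) := Fintype.ofFinite _
  have h := intValuation_jacobiSum_residueChar hm v (card_quotient_eq hℓm v.asIdeal)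
    (mul_div_eq_pow_orderOf_sub_one hℓ.out.pos) (RingHom.id _)
    (powerResidueSymbol_apply hℓm v.asIdeal) hbc hn
  rw [intValuation_natCast_eq_exp_neg_one m ((Nat.Prime.coprime_iff_not_dvd hℓ.out).mp hℓm),
    ← WithZero.exp_nsmul] at h
  rw [jacobi, Valuation.map_neg]
  refine h.trans ?_
  simp

theorem stabilizer_eq_zpowers (hℓm : ℓ.Coprime m) (L : Ideal (𝓞 K)) [L.IsMaximal]
    [L.LiesOver (Ideal.span {(ℓ : ℤ)})] :
    MulAction.stabilizer Gal(K/ℚ) L = Subgroup.zpowers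
      ((IsCyclotomicExtension.Rat.galEquivZMod m K).symm (ZMod.unitOfCoprime ℓ hℓm)) := by
  have h := IsCyclotomicExtension.Rat.galEquivZMod_stabilizer m K ℓ L hℓm
  have h2 := congrArg (Subgroup.map
    (IsCyclotomicExtension.Rat.galEquivZMod m K).symm.toMonoidHom) h
  rw [MonoidHom.map_zpowers] at h2
  rw [← MulEquiv.coe_toMonoidHom, ← h2, MulEquiv.mapSubgroup_apply, Subgroup.map_map]
  ext σ
  simp

theorem principal_jacobi (hm : 1 < m) (hℓm : ℓ.Coprime m) (L : Ideal (𝓞 K)) [L.IsMaximal]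
    [L.LiesOver (Ideal.span {(ℓ : ℤ)})] {b c : ℤ} (hb : ¬ (m : ℤ) ∣ b) (hc : ¬ (m : ℤ) ∣ c)
    (hbc : ¬ (m : ℤ) ∣ b + c) {α : MonoidAlgebra ℤ Gal(K/ℚ)}
    (hα : toRat α = theta K m b + theta K m c - theta K m (b + c)) (hs : IsShort α) :
    principal (jacobi m b c L) = idealPow L α := by
  classical
  have hmul := jacobi_mul_jacobi_neg hm hℓm L hb hc hbc
  have hℓ0 : (ℓ : 𝓞 K) ≠ 0 := by exact_mod_cast hℓ.out.ne_zero
  have hJ : jacobi m b c L ≠ 0 := fun h0 => by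
    rw [h0, zero_mul] at hmul
    exact pow_ne_zero _ hℓ0 hmul.symm
  have hbot : Ideal.span {(ℓ : ℤ)} ≠ ⊥ := by simpa using hℓ.out.ne_zero
  let v₀ : HeightOneSpectrum (𝓞 K) :=
    ⟨L, inferInstance, Ideal.ne_bot_of_liesOver_of_ne_bot hbot L⟩
  have : v₀.asIdeal.IsMaximal := ‹L.IsMaximal›
  have : v₀.asIdeal.LiesOver (Ideal.span {(ℓ : ℤ)}) := ‹L.LiesOver _›
  have hgal : IsGalois ℚ K := IsCyclotomicExtension.isGalois {m} ℚ K
  have hmem : (ℓ : 𝓞 K) ∈ L := by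
    have h := (Ideal.mem_of_liesOver L (Ideal.span {(ℓ : ℤ)}) (ℓ : ℤ)).mp
      (Ideal.mem_span_singleton_self _)
    simpa using h
  refine ext_count ?_ (idealPow_ne_zero v₀.ne_bot α) fun v => ?_
  · rw [principal, FractionalIdeal.coeIdeal_ne_zero]
    simpa using hJ
  rw [show idealPow L α = idealPow v₀.asIdeal α from rfl, count_idealPow]
  by_cases hv : (ℓ : 𝓞 K) ∈ v.asIdeal
  · have hover : v.asIdeal.LiesOver (Ideal.span {(ℓ : ℤ)}) := by
      refine ⟨Ideal.IsMaximal.eq_of_le ?_ (Ideal.IsPrime.ne_top inferInstance) ?_⟩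
      · exact PrincipalIdealRing.isMaximal_of_irreducible
          (Nat.prime_iff_prime_int.mp hℓ.out).irreducible
      · rw [Ideal.span_singleton_le_iff_mem, Ideal.mem_comap]
        simpa using hv
    obtain ⟨ρ, hρ⟩ :=
      Ideal.exists_smul_eq_of_isGaloisGroup (Ideal.span {(ℓ : ℤ)}) L v.asIdeal Gal(K/ℚ)
    obtain ⟨s, rfl⟩ : ∃ s, ((IsCyclotomicExtension.Rat.galEquivZMod m K).symm s)⁻¹ = ρ :=
      ⟨IsCyclotomicExtension.Rat.galEquivZMod m K ρ⁻¹, by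
        rw [MulEquiv.symm_apply_apply, inv_inv]⟩
    rw [← hρ, sum_filter_smul_eq_sum_range L _ _ (stabilizer_eq_zpowers hℓm L),
      MulEquiv.orderOf_eq, orderOf_unitOfCoprime]
    have hnn : ∀ σ, 0 ≤ α.coeff σ := fun σ => by rcases hs σ with h | h <;> simp [h]
    obtain ⟨n, hn⟩ := Int.eq_ofNat_of_zero_le (Finset.sum_nonneg fun i
      (_ : i ∈ Finset.range (orderOf (ℓ : ZMod m))) => hnn
        (((IsCyclotomicExtension.Rat.galEquivZMod m K).symm s)⁻¹ *
          ((IsCyclotomicExtension.Rat.galEquivZMod m K).symm (ZMod.unitOfCoprime ℓ hℓm) ^ i)⁻¹))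
    rw [hn]
    refine count_principal v ?_
    -- Here `v = σ_s⁻¹(L)`, so its valuation of `J(b, c, L)` is that of `J(s b, s c, L)` at `L`.
    rw [← intValuation_smul v v₀ (σ := (IsCyclotomicExtension.Rat.galEquivZMod m K).symm s)
      (by rw [← hρ, smul_inv_smul]), smul_jacobi L (absNorm_coprime hℓm L)]
    refine intValuation_jacobi hm hℓm v₀ ?_ ?_
    · rw [← mul_add]
      intro h
      have hco : IsCoprime (m : ℤ) ((s : ZMod m).val : ℤ) :=
        Nat.isCoprime_iff_coprime.mpr (ZMod.val_coe_unit_coprime s).symm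
      exact hbc (hco.dvd_of_dvd_mul_left h)
    · have hn' := congrArg (Int.cast : ℤ → ℚ) hn
      rw [Int.cast_sum] at hn'
      refine hn'.symm.trans (Finset.sum_congr rfl fun i _ => ?_)
      rw [← toRat_coeff, hα, ← map_pow, ← mul_inv_rev, ← map_mul, mul_comm (_ ^ i),
        MonoidAlgebra.coeff_sub, MonoidAlgebra.coeff_add, Finsupp.sub_apply, Finsupp.add_apply,
        theta_coeff, theta_coeff, theta_coeff, fract_val_mul hℓm, fract_val_mul hℓm,
        fract_val_mul hℓm, mul_add]
  · rw [Finset.sum_eq_zero]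
    · refine (count_principal v (n := 0) ?_).trans Nat.cast_zero
      rw [Nat.cast_zero, neg_zero, WithZero.exp_zero, HeightOneSpectrum.intValuation_eq_one_iff]
      intro h
      apply hv
      have := v.asIdeal.mul_mem_right (jacobi m (-b) (-c) L) h
      rw [hmul] at this
      exact v.isPrime.mem_of_pow_mem _ this
    · intro σ hσ
      exfalso
      apply hv
      rw [← (Finset.mem_filter.mp hσ).2]
      have : (ℓ : 𝓞 K) = σ • (ℓ : 𝓞 K) := by rw [← MulSemiringAction.toRingHom_apply, map_natCast]
      rw [this, Ideal.smul_mem_pointwise_smul_iff]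
      exact hmem

end MainFactorization

/-! ### Arithmetic of the prime power factors of `m` -/

section PrimePowers

variable {t : ℕ} {q : Fin t → ℕ}

theorem mem_J' {b : ℤ} {i : Fin t} : i ∈ J' q b ↔ ¬ (q i : ℤ) ∣ b := by simp [J']

theorem prod_J'_mul_r (b : ℤ) : (∏ i ∈ J' q b, q i) * r q b = ∏ i, q i := by
  rw [mul_comm, r, J, J']
  exact Finset.prod_filter_mul_prod_filter_not _ _ _

variable (hco : ∀ i j, i ≠ j → (q i).Coprime (q j))

include hco

theorem r_dvd (b : ℤ) : (r q b : ℤ) ∣ b := by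
  rw [r, Nat.cast_prod]
  refine Finset.prod_dvd_of_coprime (fun i _ j _ hij => ?_) fun i hi => ?_
  · exact Nat.isCoprime_iff_coprime.mpr (hco i j hij)
  · simpa [J] using hi

theorem J'_nonempty {b : ℤ} (hb : ¬ ((∏ i, q i : ℕ) : ℤ) ∣ b) : (J' q b).Nonempty := by
  by_contra h
  rw [Finset.not_nonempty_iff_eq_empty] at h
  apply hb
  have h1 := prod_J'_mul_r (q := q) b
  rw [h, Finset.prod_empty, one_mul] at h1
  rw [← h1]
  exact r_dvd hco b

theorem coprime_prod_erase (S : Finset (Fin t)) (j : Fin t) :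
    (q j).Coprime (∏ i ∈ S.erase j, q i) :=
  Nat.Coprime.prod_right fun i hi => hco j i (Finset.ne_of_mem_erase hi).symm

end PrimePowers

theorem div_mul_r_eq {t m : ℕ} {q : Fin t → ℕ} (hprod : ∏ i, q i = m) (hm : m ≠ 0) {b : ℤ}
    {j : Fin t} (hj : j ∈ J' q b) : m / (q j * r q b) = ∏ i ∈ (J' q b).erase j, q i := by
  have h := prod_J'_mul_r (q := q) b
  rw [← Finset.mul_prod_erase _ _ hj, hprod] at h
  have h' : m = (q j * r q b) * ∏ i ∈ (J' q b).erase j, q i := by rw [← h]; ring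
  have hpos : 0 < q j * r q b := Nat.pos_of_ne_zero fun h0 => hm (by rw [h', h0, zero_mul])
  conv_lhs => rw [h']
  exact Nat.mul_div_cancel_left _ hpos

theorem div_eq_prod_erase {t m : ℕ} {q : Fin t → ℕ} (hprod : ∏ i, q i = m) (hm : m ≠ 0)
    (j : Fin t) : m / q j = ∏ i ∈ Finset.univ.erase j, q i := by
  rw [← Finset.mul_prod_erase _ _ (Finset.mem_univ j)] at hprod
  have hpos : 0 < q j := Nat.pos_of_ne_zero fun h0 => hm (by rw [← hprod, h0, zero_mul])
  rw [← hprod, Nat.mul_div_cancel_left _ hpos]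

theorem not_dvd_of_lt {m : ℕ} {a : ℤ} (h0 : a ≠ 0) (h1 : -(m : ℤ) < a) (h2 : a < m) :
    ¬ (m : ℤ) ∣ a := fun h =>
  h0 (Int.eq_zero_of_abs_lt_dvd h (abs_lt.mpr ⟨h1, h2⟩))

/-- If `m = q * c` with a prime power `q` coprime to `c` and `m ≢ 2 [MOD 4]`, then
`2 * (m * φ q / (2 * q)) + m / p = m` for the prime `p` dividing `q`. -/
theorem two_mul_totient_div_add {q c : ℕ} (hq : IsPrimePow q) (hqc : q.Coprime c)
    (h4 : ¬ q * c ≡ 2 [MOD 4]) :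
    2 * (q * c * q.totient / (2 * q)) + q * c / q.minFac = q * c := by
  obtain ⟨p, n, hp, hn, rfl⟩ := (isPrimePow_nat_iff q).mp hq
  rw [hp.pow_minFac hn.ne', Nat.totient_prime_pow hp hn]
  obtain ⟨n, rfl⟩ := Nat.exists_eq_add_one_of_ne_zero hn.ne'
  -- The halving is exact: `φ(q)` is even unless `q = 2`, and then `c` is odd and `m = 2 c ≡ 2`
  -- modulo `4`.
  have heven : 2 ∣ c * (p ^ n * (p - 1)) := by
    have h2 : 2 < p ^ (n + 1) := by
      by_contra h
      have : p ^ (n + 1) = 2 := by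
        have := Nat.one_lt_pow hn.ne' hp.one_lt
        omega
      rw [this] at hqc h4
      apply h4
      have : c % 2 = 1 := Nat.odd_iff.mp (Nat.coprime_two_left.mp hqc)
      rw [Nat.ModEq]
      omega
    have := (Nat.totient_even h2).two_dvd
    rw [Nat.totient_prime_pow hp hn] at this
    exact this.mul_left c
  have hpos : 0 < p ^ (n + 1) := pow_pos hp.pos _
  rw [Nat.add_sub_cancel, mul_assoc (p ^ (n + 1)), mul_comm 2 (p ^ (n + 1)), Nat.mul_div_mul_left _ _ hpos,
    Nat.mul_div_cancel' heven, pow_succ', mul_assoc p, Nat.mul_div_cancel_left _ hp.pos]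
  obtain ⟨p, rfl⟩ := Nat.exists_eq_add_one_of_ne_zero hp.ne_zero
  rw [Nat.add_sub_cancel]
  ring

section Alpha

variable {K : Type*} [Field K] [NumberField K] {m : ℕ} [NeZero m] [IsCyclotomicExtension {m} ℚ K]
  {t : ℕ} {q : Fin t → ℕ}

theorem alpha_of_one_lt_card {b : ℤ} (hb : (J' q b).Nonempty) (hcard : 1 < (J' q b).card) :
    alpha q K m b = theta K m b
      + theta K m (b * (q ((J' q b).min' hb) : ℕ) * (-Nat.gcdA (q ((J' q b).min' hb))
        (m / (q ((J' q b).min' hb) * r q b))))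
      + theta K m (b * ((m / (q ((J' q b).min' hb) * r q b) : ℕ) : ℤ) *
        (-Nat.gcdB (q ((J' q b).min' hb)) (m / (q ((J' q b).min' hb) * r q b))))
      - normElt K := by
  rw [alpha, dif_pos hb]
  simp only [if_pos hcard]

theorem alpha_of_eq_div {b : ℤ} {j : Fin t} (hJ : J' q b = {j}) (hbj : b = ((m / q j : ℕ) : ℤ)) :
    alpha q K m b = 2 * theta K m ((m * Nat.totient (q j) / (2 * q j) : ℕ) : ℤ)
        + theta K m ((m / (q j).minFac : ℕ) : ℤ) - normElt K := by
  have hb : (J' q b).Nonempty := hJ ▸ Finset.singleton_nonempty j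
  have hmin : (J' q b).min' hb = j :=
    Finset.mem_singleton.mp ((Finset.ext_iff.mp hJ _).mp (Finset.min'_mem _ hb))
  have hcard : ¬ 1 < (J' q b).card := by rw [hJ]; simp
  rw [alpha, dif_pos hb]
  simp only [if_neg hcard, hmin, if_pos hbj]

theorem alpha_of_ne_div {b : ℤ} {j : Fin t} (hJ : J' q b = {j}) (hbj : b ≠ ((m / q j : ℕ) : ℤ)) :
    alpha q K m b = theta K m (-b) + theta K m (b - ((m / q j : ℕ) : ℤ))
      + theta K m ((m / q j : ℕ) : ℤ) - normElt K := by
  have hb : (J' q b).Nonempty := hJ ▸ Finset.singleton_nonempty j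
  have hmin : (J' q b).min' hb = j :=
    Finset.mem_singleton.mp ((Finset.ext_iff.mp hJ _).mp (Finset.min'_mem _ hb))
  have hcard : ¬ 1 < (J' q b).card := by rw [hJ]; simp
  rw [alpha, dif_pos hb]
  simp only [if_neg hcard, hmin, if_neg hbj]

end Alpha

/-! ### The Bézout arguments `b u x` and `b v y` -/

section SeveralPrimes

variable {t m : ℕ} {q : Fin t → ℕ} (hco : ∀ i j, i ≠ j → (q i).Coprime (q j))
  (hprod : ∏ i, q i = m) (hm : m ≠ 0)

include hprod hm

/-- From `u x + v y = -1`, `b u x ≡ -b` modulo any `q i` dividing `v` and `b v y ≡ -b` modulo `q j =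
u`. The second element of `J'_b` provides such a `q i` not dividing `b`. -/
theorem not_dvd_of_bezout {b : ℤ} {j : Fin t} (hj : j ∈ J' q b) (hcard : 1 < (J' q b).card)
    {x y : ℤ} (hxy : (q j : ℤ) * x + ((m / (q j * r q b) : ℕ) : ℤ) * y = -1) :
    ¬ (m : ℤ) ∣ b * q j * x ∧ ¬ (m : ℤ) ∣ b * ((m / (q j * r q b) : ℕ) : ℤ) * y := by
  have hqm : ∀ i, (q i : ℤ) ∣ m := fun i => by
    rw [← hprod]; exact_mod_cast Finset.dvd_prod_of_mem q (Finset.mem_univ i)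
  obtain ⟨i, hi, hij⟩ := Finset.exists_mem_ne hcard j
  have hiv : (q i : ℤ) ∣ ((m / (q j * r q b) : ℕ) : ℤ) := by
    rw [div_mul_r_eq hprod hm hj]
    exact_mod_cast Finset.dvd_prod_of_mem q (Finset.mem_erase.mpr ⟨hij, hi⟩)
  constructor
  · intro h
    apply mem_J'.mp hi
    have h1 := (hqm i).trans h
    have h2 : b = -(b * q j * x) - ((m / (q j * r q b) : ℕ) : ℤ) * (b * y) := by
      linear_combination b * hxy
    rw [h2]
    exact dvd_sub ((dvd_neg).mpr h1) (hiv.mul_right _)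
  · intro h
    apply mem_J'.mp hj
    have h1 := (hqm j).trans h
    have h2 : b = -(b * ((m / (q j * r q b) : ℕ) : ℤ) * y) - q j * (b * x) := by
      linear_combination b * hxy
    rw [h2]
    exact dvd_sub ((dvd_neg).mpr h1) (dvd_mul_right _ _)

include hco

theorem isCoprime_div_mul_r {b : ℤ} {j : Fin t} (hj : j ∈ J' q b) :
    (q j).Coprime (m / (q j * r q b)) := by
  rw [div_mul_r_eq hprod hm hj]
  exact coprime_prod_erase hco _ j

theorem dvd_mul_mul_div {b : ℤ} {j : Fin t} (hj : j ∈ J' q b) :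
    (m : ℤ) ∣ b * q j * ((m / (q j * r q b) : ℕ) : ℤ) := by
  have h := prod_J'_mul_r (q := q) b
  rw [← Finset.mul_prod_erase _ _ hj, hprod] at h
  rw [div_mul_r_eq hprod hm hj]
  obtain ⟨c, hc⟩ := r_dvd hco b
  refine ⟨c, ?_⟩
  rw [← h, Nat.cast_mul, Nat.cast_mul]
  linear_combination (q j : ℤ) * ((∏ i ∈ (J' q b).erase j, q i : ℕ) : ℤ) * hc

/-- Two solutions `x` differ by a multiple of `v`, and `m ∣ b u v`; so neither argument depends on
the solution modulo `m`. -/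
theorem dvd_sub_of_bezout {b : ℤ} {j : Fin t} (hj : j ∈ J' q b) {x y x' y' : ℤ}
    (hxy : (q j : ℤ) * x + ((m / (q j * r q b) : ℕ) : ℤ) * y = -1)
    (hxy' : (q j : ℤ) * x' + ((m / (q j * r q b) : ℕ) : ℤ) * y' = -1) :
    (m : ℤ) ∣ b * q j * x - b * q j * x' ∧
      (m : ℤ) ∣ b * ((m / (q j * r q b) : ℕ) : ℤ) * y -
        b * ((m / (q j * r q b) : ℕ) : ℤ) * y' := by
  have hcop : IsCoprime (q j : ℤ) ((m / (q j * r q b) : ℕ) : ℤ) :=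
    Nat.isCoprime_iff_coprime.mpr (isCoprime_div_mul_r hco hprod hm hj)
  have hd := dvd_mul_mul_div hco hprod hm hj
  have hx : ((m / (q j * r q b) : ℕ) : ℤ) ∣ x - x' :=
    hcop.symm.dvd_of_dvd_mul_left ⟨y' - y, by linear_combination hxy - hxy'⟩
  have hmain : (m : ℤ) ∣ b * q j * x - b * q j * x' := by
    rw [← mul_sub]
    exact hd.trans (mul_dvd_mul_left _ hx)
  refine ⟨hmain, ?_⟩
  rw [show b * ((m / (q j * r q b) : ℕ) : ℤ) * y - b * ((m / (q j * r q b) : ℕ) : ℤ) * y' =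
    -(b * q j * x - b * q j * x') by linear_combination b * (hxy - hxy')]
  exact (dvd_neg).mpr hmain

end SeveralPrimes

end ShortStickelberger

/-! ### The main theorem -/

theorem mainTheorem4 {K : Type*} [Field K] [NumberField K] (m : ℕ) [NeZero m]
    (hm1 : 1 < m) (hm2 : ¬ m ≡ 2 [MOD 4]) [IsCyclotomicExtension {m} ℚ K]
    (ℓ : ℕ) (hℓ : ℓ.Prime) (hℓm : ℓ.Coprime m)
    (L : Ideal (𝓞 K)) [L.IsMaximal] [L.LiesOver (Ideal.span {(ℓ : ℤ)})] :
    (∀ b c : ℤ, ¬ (m : ℤ) ∣ b → ¬ (m : ℤ) ∣ c → ¬ (m : ℤ) ∣ b + c →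
      ∃ α : MonoidAlgebra ℤ Gal(K/ℚ),
        ShortStickelberger.toRat α = ShortStickelberger.theta K m b
          + ShortStickelberger.theta K m c - ShortStickelberger.theta K m (b + c) ∧
        ShortStickelberger.IsShort α ∧
        ShortStickelberger.principal (ShortStickelberger.jacobi m b c L)
          = ShortStickelberger.idealPow L α) ∧
    (∀ (t : ℕ) (q : Fin t → ℕ), (∀ i, IsPrimePow (q i)) →
      (∀ i j, i ≠ j → (q i).Coprime (q j)) → ∏ i, q i = m →
      ∀ b : ℤ, 0 < b → b < m →
      ∃ α : MonoidAlgebra ℤ Gal(K/ℚ),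
        ShortStickelberger.toRat α = ShortStickelberger.alpha q K m b ∧
        ShortStickelberger.IsShort α ∧
        (1 < (ShortStickelberger.J' q b).card →
          ∀ j : Fin t, IsLeast (ShortStickelberger.J' q b : Set (Fin t)) j →
          ∀ u v x y : ℤ, u = q j → v = ((m / (q j * ShortStickelberger.r q b) : ℕ) : ℤ) →
            u * x + v * y = -1 →
            ShortStickelberger.principal
                (ShortStickelberger.jacobi m (b * u * x) (b * v * y) L)
              = ShortStickelberger.idealPow L α) ∧
        (∀ j : Fin t, ShortStickelberger.J' q b = {j} → b ≠ ((m / q j : ℕ) : ℤ) →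
          ShortStickelberger.principal
              (ShortStickelberger.jacobi m (b - ((m / q j : ℕ) : ℤ)) ((m / q j : ℕ) : ℤ) L)
            = ShortStickelberger.idealPow L α) ∧
        (∀ j : Fin t, ShortStickelberger.J' q b = {j} → b = ((m / q j : ℕ) : ℤ) →
          ShortStickelberger.principal
              (ShortStickelberger.jacobi m ((m * Nat.totient (q j) / (2 * q j) : ℕ) : ℤ)
                ((m * Nat.totient (q j) / (2 * q j) : ℕ) : ℤ) L)
            = ShortStickelberger.idealPow L α)) := by
  have : Fact ℓ.Prime := ⟨hℓ⟩
  have main : ∀ b c : ℤ, ¬ (m : ℤ) ∣ b → ¬ (m : ℤ) ∣ c → ¬ (m : ℤ) ∣ b + c →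
      ∃ α : MonoidAlgebra ℤ Gal(K/ℚ),
        ShortStickelberger.toRat α = ShortStickelberger.theta K m b
          + ShortStickelberger.theta K m c - ShortStickelberger.theta K m (b + c) ∧
        ShortStickelberger.IsShort α ∧
        ShortStickelberger.principal (ShortStickelberger.jacobi m b c L)
          = ShortStickelberger.idealPow L α := by
    intro b c hb hc hbc
    obtain ⟨α, h1, h2⟩ := ShortStickelberger.exists_isShort_theta (K := K) m b c
    exact ⟨α, h1, h2, ShortStickelberger.principal_jacobi hm1 hℓm L hb hc hbc h1 h2⟩
  refine ⟨main, fun t q hq hco hprod b hb0 hbm => ?_⟩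
  have hm0 : m ≠ 0 := by omega
  have hmb : ¬ (m : ℤ) ∣ b := ShortStickelberger.not_dvd_of_lt hb0.ne' (by omega) hbm
  have hne := ShortStickelberger.J'_nonempty hco (b := b) (by rwa [hprod])
  by_cases hcard : 1 < (ShortStickelberger.J' q b).card
  · have hj := Finset.min'_mem _ hne
    have hα := ShortStickelberger.alpha_of_one_lt_card (K := K) (m := m) hne hcard
    set j := (ShortStickelberger.J' q b).min' hne with hjdef
    have hbez : (q j : ℤ) * (-Nat.gcdA (q j) (m / (q j * ShortStickelberger.r q b))) +
        ((m / (q j * ShortStickelberger.r q b) : ℕ) : ℤ) *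
          (-Nat.gcdB (q j) (m / (q j * ShortStickelberger.r q b))) = -1 := by
      have h := Nat.gcd_eq_gcd_ab (q j) (m / (q j * ShortStickelberger.r q b))
      rw [ShortStickelberger.isCoprime_div_mul_r hco hprod hm0 hj] at h
      rw [Nat.cast_one] at h
      linear_combination h
    obtain ⟨hnx, hny⟩ := ShortStickelberger.not_dvd_of_bezout hprod hm0 hj hcard hbez
    have hsum : b * (q j : ℤ) * (-Nat.gcdA (q j) (m / (q j * ShortStickelberger.r q b))) +
        b * ((m / (q j * ShortStickelberger.r q b) : ℕ) : ℤ) *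
          (-Nat.gcdB (q j) (m / (q j * ShortStickelberger.r q b))) = -b := by
      linear_combination b * hbez
    obtain ⟨α, h1, h2, h3⟩ := main _ _ hnx hny (by rw [hsum, dvd_neg]; exact hmb)
    refine ⟨α, ?_, h2, ?_, ?_, ?_⟩
    -- The arguments sum to `-b`, and `-θ_m(-b) = θ_m(b) - N_m` by reflection.
    · rw [h1, hα, hsum, ← ShortStickelberger.theta_add_neg (K := K) m hmb]
      abel
    · rintro - i hi u v x y rfl rfl hxy
      obtain rfl : i = j := hi.unique (Finset.isLeast_min' _ hne)
      obtain ⟨hx, hy⟩ := ShortStickelberger.dvd_sub_of_bezout hco hprod hm0 hj hxy hbez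
      rw [ShortStickelberger.jacobi_congr L (ShortStickelberger.absNorm_coprime hℓm L) hx hy, h3]
    · intro i hi; rw [hi] at hcard; simp at hcard
    · intro i hi; rw [hi] at hcard; simp at hcard
  have hcard1 : (ShortStickelberger.J' q b).card = 1 := by
    have := hne.card_pos
    omega
  obtain ⟨j, hJ⟩ := Finset.card_eq_one.mp hcard1
  have huniq : ∀ i, ShortStickelberger.J' q b = {i} → i = j := fun i hi =>
    (Finset.singleton_injective (hJ.symm.trans hi)).symm
  have hmul : q j * (m / q j) = m := Nat.mul_div_cancel'
    (hprod ▸ Finset.dvd_prod_of_mem q (Finset.mem_univ j))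
  have hq1 := (hq j).one_lt
  by_cases hbj : b = ((m / q j : ℕ) : ℤ)
  · have hcop : (q j).Coprime (m / q j) := by
      rw [ShortStickelberger.div_eq_prod_erase hprod hm0 j]
      exact ShortStickelberger.coprime_prod_erase hco _ j
    have hkey := ShortStickelberger.two_mul_totient_div_add (hq j) hcop (by rwa [hmul])
    rw [hmul] at hkey
    have hp := Nat.minFac_prime hq1.ne'
    have hpm : (q j).minFac ∣ m := (Nat.minFac_dvd _).trans (Dvd.intro _ hmul)
    have hlt : m / (q j).minFac < m := Nat.div_lt_self (by omega) hp.one_lt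
    have hpos : 0 < m / (q j).minFac := Nat.div_pos (Nat.le_of_dvd (by omega) hpm) hp.pos
    have hα := ShortStickelberger.alpha_of_eq_div (K := K) (m := m) hJ hbj
    set d := m * Nat.totient (q j) / (2 * q j)
    -- By `hkey`, `2 d = m - m / p` with `0 < m / p < m`, so `0 < d < 2 d < m`.
    have hd : ¬ (m : ℤ) ∣ (d : ℤ) :=
      ShortStickelberger.not_dvd_of_lt (by omega) (by omega) (by omega)
    have hdd : ¬ (m : ℤ) ∣ (d : ℤ) + d :=
      ShortStickelberger.not_dvd_of_lt (by omega) (by omega) (by omega)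
    obtain ⟨α, h1, h2, h3⟩ := main d d hd hd hdd
    refine ⟨α, ?_, h2, fun h => absurd h hcard, ?_, ?_⟩
    · have hmp : ¬ (m : ℤ) ∣ ((m / (q j).minFac : ℕ) : ℤ) :=
        ShortStickelberger.not_dvd_of_lt (by omega) (by omega) (by omega)
      -- Since `2 d ≡ -m / p` modulo `m`, reflection at `m / p` turns `-θ_m(2 d)` into `θ_m(m / p) -
      -- N_m`.
      rw [h1, hα, ← ShortStickelberger.theta_add_neg (K := K) m hmp,
        ShortStickelberger.theta_congr (K := K) m
          (show (m : ℤ) ∣ ((d : ℤ) + d) - -((m / (q j).minFac : ℕ) : ℤ) from ⟨1, by omega⟩),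
        two_mul]
      abel
    · intro i hi hbi
      rw [huniq i hi] at hbi
      exact absurd hbj hbi
    · intro i hi _
      rw [huniq i hi]
      exact h3
  · have hα := ShortStickelberger.alpha_of_ne_div (K := K) (m := m) hJ hbj
    have hcpos : 0 < m / q j := Nat.pos_of_ne_zero fun h0 => hm0 (by rw [← hmul, h0, mul_zero])
    have hclt : m / q j < m := Nat.div_lt_self (by omega) hq1
    have hc : ¬ (m : ℤ) ∣ ((m / q j : ℕ) : ℤ) :=
      ShortStickelberger.not_dvd_of_lt (by omega) (by omega) (by omega)
    have hbc : ¬ (m : ℤ) ∣ b - ((m / q j : ℕ) : ℤ) :=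
      ShortStickelberger.not_dvd_of_lt (by omega) (by omega) (by omega)
    obtain ⟨α, h1, h2, h3⟩ := main _ _ hbc hc (by rwa [sub_add_cancel])
    refine ⟨α, ?_, h2, fun h => absurd h hcard, ?_, ?_⟩
    · rw [h1, hα, sub_add_cancel, ← ShortStickelberger.theta_add_neg (K := K) m hmb]
      abel
    · intro i hi _
      rw [huniq i hi]
      exact h3
    · intro i hi hbi
      rw [huniq i hi] at hbi
      exact absurd hbi hbj
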